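/- Let $\Omega=[a,b]\subset\mathbb{R}$ with $a<b$, let $\Theta\subset\mathbb{R}^d$ be open, and let $\rho(\cdot,\theta)$, $\theta\in\Theta$, be probability densities on $\Omega$ that are positive and $C^\infty$ on $\Omega$. Let $F(x,\theta)=\int_a^x\rho(y,\theta)\,dy$, and suppose that for every $x\in\Omega$ the functions $\theta\mapsto\rho(x,\theta)$ and $\theta\mapsto F(x,\theta)$ are of class $C^1$ and $C^2$ on $\Theta$, respectively. Assume: (1) for every $\theta\in\Theta$ and $\xi\in\mathbb{R}^d$ there is a smooth $\Phi_\xi$ on $\Omega$ (depending on $\theta$) with $-(\rho(x,\theta)\,\Phi_\xi'(x))'=\langle\nabla_\theta\rho(x,\theta),\xi\rangle$ on $\Omega$, $\Phi_\xi'(a)=\Phi_\xi'(b)=0$ and $\int_\Omega\rho(x,\theta)|\Phi_\xi'(x)|^2dx<\infty$; (2) every $\theta_0\in\Theta$ has a neighbourhood $N\subset\Theta$ such that, for all $1\le i,j\le d$, the functions $\max_{\theta\in N}\left|\frac{\partial^2F(x,\theta)}{\partial\theta_i\partial\theta_j}\right|$, $\max_{\theta\in N}\left|\frac{\partial\rho(x,\theta)}{\partial\theta_i}\right|$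 and $\max_{\theta\in N}\frac{1}{\rho(x,\theta)}\left|\frac{\partial F(x,\theta)}{\partial\theta_i}\frac{\partial F(x,\theta)}{\partial\theta_j}\right|$ of $x$ have finite integral over $\Omega$ (in the sense that there is an integrable majorant in $x$ that is valid for all $\theta\in N$). Let $G_W(\theta)$ be the matrix of the Wasserstein metric tensor $g_\theta(\xi,\eta)=\xi^TG_W(\theta)\eta=\int_\Omega\rho(x,\theta)\,\Phi_\xi'(x)\Phi_\eta'(x)\,dx$. Let $\theta^*\in\Theta$, $\rho^*=\rho(\cdot,\theta^*)$ and $R(\theta)=\frac12W_2(\rho(\cdot,\theta),\rho^*)^2$, where $W_2$ is the $L^2$-Wasserstein distance. Then $R$ is twice differentiable on $\Theta$, the integral below converges, and $$\lim_{\theta\to\theta^*}\nabla_\theta^2R(\theta)=\int_\Omega\frac{1}{\rho(x,\theta^*)}(\nabla_\theta F(x,\theta^*))^T\nabla_\theta F(x,\theta^*)\,dx=G_W(\theta^*),$$ and the limit is also the value of $\nabla_\theta^2R$ at $\theta^*$. Hence Wasserstein natural gradient descent is asymptotically Newton's method: $\nabla^2_\theta R(\theta)-G_W(\theta)\to0$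 as $\theta\to\theta^*$, and, if $G_W(\theta^*)$ is positive definite, then $G_W(\theta)$ and $\nabla_\theta^2R(\theta)$ are invertible for all $\theta$ near $\theta^*$ and, for every step size $\tau\in\mathbb{R}$, $$\bigl(\theta-\tau\,G_W(\theta)^{-1}\nabla_\theta R(\theta)\bigr)-\bigl(\theta-\tau\,(\nabla^2_\theta R(\theta))^{-1}\nabla_\theta R(\theta)\bigr)=o\bigl(|\nabla_\theta R(\theta)|\bigr)\quad\text{as }\theta\to\theta^*.$$ -/

import Mathlib

open Set Filter Topology MeasureTheory
open scoped ENNReal ContDiff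

namespace WassersteinNG

/-! ### Partial derivatives and Hessians on `ℝ^d` -/

/-- The partial derivative `∂f/∂θ_i`. -/
noncomputable def partialDeriv {d : ℕ} (i : Fin d) (f : EuclideanSpace ℝ (Fin d) → ℝ)
    (θ : EuclideanSpace ℝ (Fin d)) : ℝ :=
  fderiv ℝ f θ (EuclideanSpace.single i 1)

/-- The Hessian matrix `∇²_θ f = (∂²f/∂θ_i∂θ_j)_{ij}`. -/
noncomputable def hessianMatrix {d : ℕ} (f : EuclideanSpace ℝ (Fin d) → ℝ)
    (θ : EuclideanSpace ℝ (Fin d)) : Matrix (Fin d) (Fin d) ℝ :=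
  Matrix.of fun i j => partialDeriv i (partialDeriv j f) θ

/-! ### The quadratic Wasserstein distance -/

/-- The Kantorovich problem with quadratic cost: the infimum of `∫ |x - y|² dπ(x, y)` over all
couplings `π` of `μ` and `ν`. -/
noncomputable def quadraticTransportCost (μ ν : Measure ℝ) : ℝ≥0∞ :=
  ⨅ π ∈ {π : Measure (ℝ × ℝ) | π.map Prod.fst = μ ∧ π.map Prod.snd = ν},
    ∫⁻ p, edist p.1 p.2 ^ 2 ∂π

/-- The `L²`-Wasserstein distance. -/
noncomputable def W2 (μ ν : Measure ℝ) : ℝ :=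
  Real.sqrt (quadraticTransportCost μ ν).toReal

/-- The measure on `Ω = [a, b]` with Lebesgue density `p`. -/
noncomputable def densityMeasure (a b : ℝ) (p : ℝ → ℝ) : Measure ℝ :=
  (volume.restrict (Icc a b)).withDensity fun x => ENNReal.ofReal (p x)

/-! ### Statistical models on the compact interval `Ω = [a, b]` -/

/-- The cumulative distribution function `F(x, θ)`, for `x ∈ [a, b]`. -/
noncomputable def cdf {d : ℕ} (a : ℝ) (ρ : ℝ → EuclideanSpace ℝ (Fin d) → ℝ) (x : ℝ)
    (θ : EuclideanSpace ℝ (Fin d)) : ℝ :=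
  ∫ y in a..x, ρ y θ

/-- `(Ω, Θ, ρ)` with `Ω = [a, b]` is a statistical model: every `ρ(·, θ)` is a probability density
that is positive and smooth on `Ω`, and the `θ`-derivatives of `ρ` (first order) and of its
distribution function `F` (up to second order) exist and are continuous in `θ`. -/
structure IsStatisticalModel {d : ℕ} (a b : ℝ) (Θ : Set (EuclideanSpace ℝ (Fin d)))
    (ρ : ℝ → EuclideanSpace ℝ (Fin d) → ℝ) : Prop where
  pos : ∀ θ ∈ Θ, ∀ x ∈ Icc a b, 0 < ρ x θ
  smooth : ∀ θ ∈ Θ, ContDiffOn ℝ ∞ (fun x => ρ x θ) (Icc a b)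
  integral_eq_one : ∀ θ ∈ Θ, ∫ x in Icc a b, ρ x θ = 1
  density_contDiffOn : ∀ x ∈ Icc a b, ContDiffOn ℝ 1 (ρ x) Θ
  cdf_contDiffOn : ∀ x ∈ Icc a b, ContDiffOn ℝ 2 (cdf a ρ x) Θ

/-- `Φ` is a smooth solution with finite energy of the Neumann problem
`-(ρ(x, θ) Φ'(x))' = d_ξ ρ(x, θ)` on `[a, b]`, `Φ'(a) = Φ'(b) = 0`. The derivatives in `x` are
taken within `[a, b]`, hence one-sided at the end points. -/
structure IsPotential {d : ℕ} (a b : ℝ) (ρ : ℝ → EuclideanSpace ℝ (Fin d) → ℝ)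
    (θ ξ : EuclideanSpace ℝ (Fin d)) (Φ : ℝ → ℝ) : Prop where
  smooth : ContDiffOn ℝ ∞ Φ (Icc a b)
  equation : ∀ x ∈ Icc a b,
    -derivWithin (fun y => ρ y θ * derivWithin Φ (Icc a b) y) (Icc a b) x = fderiv ℝ (ρ x) θ ξ
  neumann_left : derivWithin Φ (Icc a b) a = 0
  neumann_right : derivWithin Φ (Icc a b) b = 0
  finite_energy : IntegrableOn (fun x => ρ x θ * derivWithin Φ (Icc a b) x ^ 2) (Icc a b)

/-- The elliptic Neumann problem is solvable for every parameter and every tangent vector. -/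
def EllipticAssumption {d : ℕ} (a b : ℝ) (Θ : Set (EuclideanSpace ℝ (Fin d)))
    (ρ : ℝ → EuclideanSpace ℝ (Fin d) → ℝ) : Prop :=
  ∀ θ ∈ Θ, ∀ ξ : EuclideanSpace ℝ (Fin d), ∃ Φ : ℝ → ℝ, IsPotential a b ρ θ ξ Φ

/-- `∫_Ω max_{θ ∈ N} |h(x, θ)| dx < ∞` for `Ω = [a, b]`: the functions `|h(·, θ)|`, `θ ∈ N`, have
a common integrable majorant. -/
def HasIntegrableMax {d : ℕ} (a b : ℝ) (N : Set (EuclideanSpace ℝ (Fin d)))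
    (h : ℝ → EuclideanSpace ℝ (Fin d) → ℝ) : Prop :=
  ∃ g : ℝ → ℝ, IntegrableOn g (Icc a b) ∧
    ∀ᵐ x ∂(volume.restrict (Icc a b)), ∀ θ ∈ N, |h x θ| ≤ g x

/-- The local domination of the `θ`-derivatives of `F` and `ρ`. -/
def DominationAssumption {d : ℕ} (a b : ℝ) (Θ : Set (EuclideanSpace ℝ (Fin d)))
    (ρ : ℝ → EuclideanSpace ℝ (Fin d) → ℝ) : Prop :=
  ∀ θ₀ ∈ Θ, ∃ N ∈ 𝓝 θ₀, N ⊆ Θ ∧ ∀ i j : Fin d,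
    HasIntegrableMax a b N (fun x θ => partialDeriv i (partialDeriv j (cdf a ρ x)) θ) ∧
    HasIntegrableMax a b N (fun x θ => partialDeriv i (ρ x) θ) ∧
    HasIntegrableMax a b N (fun x θ =>
      1 / ρ x θ * |partialDeriv i (cdf a ρ x) θ * partialDeriv j (cdf a ρ x) θ|)

/-! ### The Wasserstein metric tensor in parameter space -/

/-- Solutions of the Neumann problem differ by constants: their derivatives agree. -/
theorem IsPotential.derivWithin_eq {d : ℕ} {a b : ℝ} (hab : a < b)
    {Θ : Set (EuclideanSpace ℝ (Fin d))} {ρ : ℝ → EuclideanSpace ℝ (Fin d) → ℝ}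
    (hρ : IsStatisticalModel a b Θ ρ) {θ ξ : EuclideanSpace ℝ (Fin d)} (hθ : θ ∈ Θ)
    {Φ Ψ : ℝ → ℝ} (hΦ : IsPotential a b ρ θ ξ Φ) (hΨ : IsPotential a b ρ θ ξ Ψ) :
    ∀ x ∈ Icc a b, derivWithin Φ (Icc a b) x = derivWithin Ψ (Icc a b) x := by
  have key : ∀ {X : ℝ → ℝ}, IsPotential a b ρ θ ξ X →
      DifferentiableOn ℝ (fun y => ρ y θ * derivWithin X (Icc a b) y) (Icc a b) := by
    intro X hX
    have h1 : DifferentiableOn ℝ (fun y => ρ y θ) (Icc a b) :=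
      (hρ.smooth θ hθ).differentiableOn (by simp)
    have h2 : ContDiffOn ℝ 1 (derivWithin X (Icc a b)) (Icc a b) :=
      hX.smooth.derivWithin (uniqueDiffOn_Icc hab) (by norm_cast)
    exact h1.mul (h2.differentiableOn (by simp))
  intro x hx
  have heq := eq_of_derivWithin_eq (key hΦ) (key hΨ)
    (fun y hy => by
      have e1 := hΦ.equation y (Ico_subset_Icc_self hy)
      have e2 := hΨ.equation y (Ico_subset_Icc_self hy)
      linarith)
    (by simp only [hΦ.neumann_left, hΨ.neumann_left]) x hx
  exact mul_left_cancel₀ (hρ.pos θ hθ x hx).ne' heq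

/-- A solution `Φ_ξ` of the Neumann problem (any one, whenever there is one). -/
noncomputable def potential {d : ℕ} (a b : ℝ) (ρ : ℝ → EuclideanSpace ℝ (Fin d) → ℝ)
    (θ ξ : EuclideanSpace ℝ (Fin d)) : ℝ → ℝ :=
  Classical.epsilon fun Φ => IsPotential a b ρ θ ξ Φ

/-- The `L²`-Wasserstein metric tensor `g_θ(ξ, η) = ∫_Ω ρ(x, θ) Φ_ξ'(x) Φ_η'(x) dx`. -/
noncomputable def metricTensor {d : ℕ} (a b : ℝ) (ρ : ℝ → EuclideanSpace ℝ (Fin d) → ℝ)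
    (θ ξ η : EuclideanSpace ℝ (Fin d)) : ℝ :=
  ∫ x in Icc a b, ρ x θ * (derivWithin (potential a b ρ θ ξ) (Icc a b) x *
    derivWithin (potential a b ρ θ η) (Icc a b) x)

/-- The metric tensor does not depend on the choice of the potentials. -/
theorem metricTensor_eq {d : ℕ} {a b : ℝ} (hab : a < b)
    {Θ : Set (EuclideanSpace ℝ (Fin d))} {ρ : ℝ → EuclideanSpace ℝ (Fin d) → ℝ}
    (hρ : IsStatisticalModel a b Θ ρ) {θ ξ η : EuclideanSpace ℝ (Fin d)} (hθ : θ ∈ Θ)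
    {Φ Ψ : ℝ → ℝ} (hΦ : IsPotential a b ρ θ ξ Φ) (hΨ : IsPotential a b ρ θ η Ψ) :
    metricTensor a b ρ θ ξ η =
      ∫ x in Icc a b, ρ x θ * (derivWithin Φ (Icc a b) x * derivWithin Ψ (Icc a b) x) := by
  have h1 : IsPotential a b ρ θ ξ (potential a b ρ θ ξ) :=
    Classical.epsilon_spec (p := fun X => IsPotential a b ρ θ ξ X) ⟨Φ, hΦ⟩
  have h2 : IsPotential a b ρ θ η (potential a b ρ θ η) :=
    Classical.epsilon_spec (p := fun X => IsPotential a b ρ θ η X) ⟨Ψ, hΨ⟩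
  refine setIntegral_congr_fun measurableSet_Icc fun x hx => ?_
  simp only [h1.derivWithin_eq hab hρ hθ hΦ x hx, h2.derivWithin_eq hab hρ hθ hΨ x hx]

/-- The matrix `G_W(θ)` of the Wasserstein metric tensor: `g_θ(ξ, η) = ξᵀ G_W(θ) η`. -/
noncomputable def metricMatrix {d : ℕ} (a b : ℝ) (ρ : ℝ → EuclideanSpace ℝ (Fin d) → ℝ)
    (θ : EuclideanSpace ℝ (Fin d)) : Matrix (Fin d) (Fin d) ℝ :=
  Matrix.of fun i j =>
    metricTensor a b ρ θ (EuclideanSpace.single i 1) (EuclideanSpace.single j 1)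

/-- The integrand `(1/ρ(x, θ)) ∂_i F(x, θ) ∂_j F(x, θ)`. -/
noncomputable def cdfIntegrand {d : ℕ} (a : ℝ) (ρ : ℝ → EuclideanSpace ℝ (Fin d) → ℝ)
    (θ : EuclideanSpace ℝ (Fin d)) (i j : Fin d) (x : ℝ) : ℝ :=
  1 / ρ x θ * (partialDeriv i (cdf a ρ x) θ * partialDeriv j (cdf a ρ x) θ)

/-- The matrix `∫_Ω (1/ρ) (∇_θ F)ᵀ ∇_θ F dx`. -/
noncomputable def cdfMatrix {d : ℕ} (a b : ℝ) (ρ : ℝ → EuclideanSpace ℝ (Fin d) → ℝ)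
    (θ : EuclideanSpace ℝ (Fin d)) : Matrix (Fin d) (Fin d) ℝ :=
  Matrix.of fun i j => ∫ x in Icc a b, cdfIntegrand a ρ θ i j x

/-! ### The objective function and the iterations -/

/-- `R(ρ(·, θ)) = ½ W₂(ρ(·, θ), ρ*)²`. -/
noncomputable def objective {d : ℕ} (a b : ℝ) (ρ : ℝ → EuclideanSpace ℝ (Fin d) → ℝ)
    (ρstar : ℝ → ℝ) (θ : EuclideanSpace ℝ (Fin d)) : ℝ :=
  1 / 2 * W2 (densityMeasure a b fun x => ρ x θ) (densityMeasure a b ρstar) ^ 2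

/-- One step `θ ↦ θ - τ P⁻¹ ∇R(θ)` of gradient descent with preconditioning matrix `P`: natural
gradient descent for `P = G_W(θ)`, Newton's method for `P = ∇²R(θ)`. -/
noncomputable def preconditionedStep {d : ℕ} (P : Matrix (Fin d) (Fin d) ℝ)
    (R : EuclideanSpace ℝ (Fin d) → ℝ) (τ : ℝ) (θ : EuclideanSpace ℝ (Fin d)) :
    EuclideanSpace ℝ (Fin d) :=
  θ - τ • Matrix.toEuclideanLin P⁻¹ (gradient R θ)

end WassersteinNG

/-!
On the line the optimal map from `ρ(·, θ)` to `ρ*` is the monotone rearrangement `T = Q ∘ F(·, θ)`,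
where `Q` is the quantile function of `ρ*` (`map_densityMeasure`). Optimality is certified by explicit
Kantorovich potentials, obtained by integrating an elementary inequality between indicator functions
(`exists_dual_potentials`, `quadraticTransportCost_map_eq`). Expanding the square in
`∫ (x - T x)² ρ dx` and integrating by parts removes the density (`half_W2_sq_eq`): with
`ψ' = b - Q` and `ψ 0 = 0`,

`R(θ) = C + ∫_a^b ((b - s) F(s, θ) - ψ(F(s, θ))) ds`.

The parameter now enters only through `F`, and the `u`-derivative of the integrand `(b - s) u - ψ u`
is `Q u - s`. As `Q' = 1 / (ρ* ∘ Q)`, differentiating twice under the integral sign gives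
(`derivatives_of_eq_integral`)

`∂_j R = ∫ (Q(F) - s) ∂_j F ds`,
`∂_i ∂_j R = ∫ ((Q(F) - s) ∂_i ∂_j F + ∂_i F ∂_j F / ρ*(Q(F))) ds`.

Domination is available because the density `ρ*` is bounded below on the compact interval and
`∂_i F = ∫_a^x ∂_i ρ` is locally bounded (`DominationAssumption.exists_isOpen`). At the target
parameter `Q ∘ F = id`, so by dominated convergence the Hessian tends to `∫ ∂_i F ∂_j F / ρ* ds`.

Integrating the Neumann problem gives `ρ Φ_i' = -∂_i F`, which identifies this integral with the metric
matrix, at every parameter (`metricMatrix_eq_cdfMatrix`), and the metric matrix is continuous at the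
target parameter. Hence it and the Hessian have the same limit; if that limit is invertible, so do
their inverses, and the two preconditioned steps differ by a matrix tending to zero applied to the
gradient (`isLittleO_preconditionedStep_sub`).
-/

namespace WassersteinNG

/-! ### Partial derivatives of parameter integrals -/

section Partial

variable {d : ℕ}

theorem fderiv_eq_sum_partialDeriv (f : EuclideanSpace ℝ (Fin d) → ℝ)
    (θ : EuclideanSpace ℝ (Fin d)) :
    fderiv ℝ f θ = ∑ i, partialDeriv i f θ • EuclideanSpace.proj (𝕜 := ℝ) i := by
  ext v
  have hv : v = ∑ i, v i • EuclideanSpace.single i (1 : ℝ) := by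
    ext j
    simp [Pi.single_apply]
  conv_lhs => rw [hv]
  simp [partialDeriv, map_sum, mul_comm]

theorem norm_fderiv_le_sum_partialDeriv (f : EuclideanSpace ℝ (Fin d) → ℝ)
    (θ : EuclideanSpace ℝ (Fin d)) :
    ‖fderiv ℝ f θ‖ ≤ ∑ i, |partialDeriv i f θ| := by
  rw [fderiv_eq_sum_partialDeriv]
  refine (norm_sum_le _ _).trans (Finset.sum_le_sum fun i _ => ?_)
  rw [norm_smul, Real.norm_eq_abs]
  refine mul_le_of_le_one_right (abs_nonneg _) ?_
  refine ContinuousLinearMap.opNorm_le_bound _ zero_le_one fun v => ?_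
  simpa using PiLp.norm_apply_le v i

theorem partialDeriv_comp {φ : ℝ → ℝ} {φ' : ℝ} {f : EuclideanSpace ℝ (Fin d) → ℝ}
    {θ : EuclideanSpace ℝ (Fin d)} (i : Fin d) (hφ : HasDerivAt φ φ' (f θ))
    (hf : DifferentiableAt ℝ f θ) :
    partialDeriv i (fun η => φ (f η)) θ = φ' * partialDeriv i f θ := by
  have h := hφ.comp_hasFDerivAt θ hf.hasFDerivAt
  simp only [partialDeriv]
  rw [show (fun η => φ (f η)) = φ ∘ f from rfl, h.fderiv]
  simp

theorem partialDeriv_mul {f g : EuclideanSpace ℝ (Fin d) → ℝ}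
    {θ : EuclideanSpace ℝ (Fin d)} (i : Fin d)
    (hf : DifferentiableAt ℝ f θ) (hg : DifferentiableAt ℝ g θ) :
    partialDeriv i (fun η => f η * g η) θ =
      f θ * partialDeriv i g θ + g θ * partialDeriv i f θ := by
  simp only [partialDeriv]
  rw [fderiv_fun_mul hf hg]
  simp

/-- A partial derivative is a pointwise limit of difference quotients, hence inherits
measurability in the other variable. -/
theorem aestronglyMeasurable_partialDeriv {μ : Measure ℝ}
    {f : ℝ → EuclideanSpace ℝ (Fin d) → ℝ} {θ : EuclideanSpace ℝ (Fin d)} (i : Fin d)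
    (hm : ∀ᶠ η in 𝓝 θ, AEStronglyMeasurable (fun s => f s η) μ)
    (hd : ∀ᵐ s ∂μ, DifferentiableAt ℝ (f s) θ) :
    AEStronglyMeasurable (fun s => partialDeriv i (f s) θ) μ := by
  set e : EuclideanSpace ℝ (Fin d) := EuclideanSpace.single i 1 with he
  have hlim : Tendsto (fun n : ℕ => θ + (n : ℝ)⁻¹ • e) atTop (𝓝 θ) := by
    have h := (tendsto_inv_atTop_nhds_zero_nat (𝕜 := ℝ)).smul_const e
    simpa using h.const_add θ
  obtain ⟨n₀, hn₀⟩ := eventually_atTop.1 (hlim.eventually hm)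
  refine aestronglyMeasurable_of_tendsto_ae atTop
    (f := fun (n : ℕ) s => ((n + n₀ : ℕ) : ℝ) • (f s (θ + ((n + n₀ : ℕ) : ℝ)⁻¹ • e) - f s θ))
    (fun n => ((hn₀ (n + n₀) (Nat.le_add_left _ _)).sub hm.self_of_nhds).const_smul
      ((n + n₀ : ℕ) : ℝ)) ?_
  filter_upwards [hd] with s hs
  refine hs.hasFDerivAt.lim e (c := fun n : ℕ => ((n + n₀ : ℕ) : ℝ)) ?_
  simp only [Real.norm_natCast]
  exact tendsto_natCast_atTop_atTop.comp (tendsto_add_atTop_nat n₀)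

/-- Differentiation under the integral sign, with the domination required of the partial
derivatives one at a time. -/
theorem differentiableAt_integral_of_partialDeriv_le {μ : Measure ℝ}
    {f : ℝ → EuclideanSpace ℝ (Fin d) → ℝ} {θ : EuclideanSpace ℝ (Fin d)}
    {N : Set (EuclideanSpace ℝ (Fin d))} (hN : N ∈ 𝓝 θ)
    (hm : ∀ η ∈ N, AEStronglyMeasurable (fun s => f s η) μ)
    (hint : Integrable (fun s => f s θ) μ)
    (hd : ∀ᵐ s ∂μ, ∀ η ∈ N, DifferentiableAt ℝ (f s) η)
    (hb : ∀ i, ∃ g : ℝ → ℝ, Integrable g μ ∧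
      ∀ᵐ s ∂μ, ∀ η ∈ N, |partialDeriv i (f s) η| ≤ g s) :
    DifferentiableAt ℝ (fun η => ∫ s, f s η ∂μ) θ ∧
      ∀ i, partialDeriv i (fun η => ∫ s, f s η ∂μ) θ = ∫ s, partialDeriv i (f s) θ ∂μ := by
  choose g hg hgb using hb
  have hθ : θ ∈ N := mem_of_mem_nhds hN
  have hm' : ∀ᶠ η in 𝓝 θ, AEStronglyMeasurable (fun s => f s η) μ :=
    eventually_of_mem hN hm
  have hmeas : AEStronglyMeasurable (fun s => fderiv ℝ (f s) θ) μ := by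
    have : (fun s => fderiv ℝ (f s) θ) =
        fun s => ∑ i, partialDeriv i (f s) θ • EuclideanSpace.proj (𝕜 := ℝ) i :=
      funext fun s => fderiv_eq_sum_partialDeriv _ _
    rw [this]
    refine Finset.aestronglyMeasurable_fun_sum _ fun i _ => ?_
    exact (aestronglyMeasurable_partialDeriv i hm' (hd.mono fun s hs => hs θ hθ)).smul_const _
  have hbound : ∀ᵐ s ∂μ, ∀ η ∈ N, ‖fderiv ℝ (f s) η‖ ≤ ∑ i, g i s := by
    filter_upwards [ae_all_iff.2 hgb] with s hs η hη
    exact (norm_fderiv_le_sum_partialDeriv _ _).trans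
      (Finset.sum_le_sum fun i _ => hs i η hη)
  have hgi : Integrable (fun s => ∑ i, g i s) μ := integrable_finsetSum _ fun i _ => hg i
  have key := hasFDerivAt_integral_of_dominated_of_fderiv_le (F := fun η s => f s η)
    (F' := fun η s => fderiv ℝ (f s) η) hN hm' hint hmeas hbound hgi
    (hd.mono fun s hs η hη => (hs η hη).hasFDerivAt)
  refine ⟨key.differentiableAt, fun i => ?_⟩
  have hI : Integrable (fun s => fderiv ℝ (f s) θ) μ :=
    hgi.mono' hmeas (hbound.mono fun s hs => hs θ hθ)
  simp only [partialDeriv]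
  rw [key.fderiv, ContinuousLinearMap.integral_apply hI]

end Partial

/-! ### Quantile functions -/

/-- A distribution function with a continuous density that is bounded below by a positive
constant on all of `ℝ` is a bijection of `ℝ`; its inverse is the quantile function. -/
theorem exists_quantile (a : ℝ) {g : ℝ → ℝ} (hg : Continuous g) {m : ℝ} (hm : 0 < m)
    (hgm : ∀ x, m ≤ g x) :
    ∃ Q : ℝ → ℝ, (∀ x, Q (∫ y in a..x, g y) = x) ∧ ∀ u, HasDerivAt Q (g (Q u))⁻¹ u := by
  set G : ℝ → ℝ := fun x => ∫ y in a..x, g y with hG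
  have hGd : ∀ x, HasDerivAt G (g x) x := fun x =>
    (hg.integral_hasStrictDerivAt a x).hasDerivAt
  have hGc : Continuous G := continuous_iff_continuousAt.2 fun x => (hGd x).continuousAt
  have hmono : StrictMono G :=
    strictMono_of_hasDerivAt_pos hGd fun x => hm.trans_le (hgm x)
  have hlin : Monotone fun x => G x - m * x := by
    refine monotone_of_hasDerivAt_nonneg (f' := fun x => g x - m)
      (fun x => ?_) (fun x => sub_nonneg.2 (hgm x))
    have h := (hGd x).sub ((hasDerivAt_id x).const_mul m)
    rw [mul_one] at h
    exact h
  have hGa : G a = 0 := by simp [hG]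
  have htop : Tendsto G atTop atTop := by
    refine tendsto_atTop_mono' (f₁ := fun x => m * x + -(m * a)) atTop ?_
      (tendsto_atTop_add_const_right _ _ (tendsto_id.const_mul_atTop hm))
    filter_upwards [eventually_ge_atTop a] with x hx
    have := hlin hx
    simp only [hGa] at this
    linarith
  have hbot : Tendsto G atBot atBot := by
    refine tendsto_atBot_mono' (f₂ := G) (f₁ := fun x => m * x + -(m * a)) atBot ?_
      (tendsto_atBot_add_const_right _ _ (tendsto_id.const_mul_atBot hm))
    filter_upwards [eventually_le_atBot a] with x hx
    have := hlin hx
    simp only [hGa] at this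
    linarith
  let e : ℝ ≃o ℝ := hmono.orderIsoOfSurjective G (hGc.surjective htop hbot)
  have he : ∀ u, G (e.symm u) = u := fun u => e.apply_symm_apply u
  refine ⟨e.symm, fun x => e.symm_apply_apply x, fun u => ?_⟩
  exact HasDerivAt.of_local_left_inverse e.symm.continuous.continuousAt (hGd _)
    (hm.trans_le (hgm _)).ne' (Eventually.of_forall he)

/-! ### The quadratic transport problem on the line -/

/-- Kantorovich duality, in the easy direction: potentials that are tight along the graph of `T`
certify that `T` is optimal. -/
theorem quadraticTransportCost_map_eq {μ : Measure ℝ} {T α β : ℝ → ℝ}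
    (hT : Measurable T) (hα : Integrable α μ) (hβ : Integrable β (μ.map T))
    (hle : ∀ᵐ x ∂μ, ∀ y, α x + β y ≤ (x - y) ^ 2)
    (heq : ∀ᵐ x ∂μ, α x + β (T x) = (x - T x) ^ 2) :
    quadraticTransportCost μ (μ.map T) = ENNReal.ofReal (∫ x, (x - T x) ^ 2 ∂μ) := by
  have hedist : ∀ x y : ℝ, edist x y ^ 2 = ENNReal.ofReal ((x - y) ^ 2) := fun x y => by
    rw [edist_dist, Real.dist_eq, ← ENNReal.ofReal_pow (abs_nonneg _), sq_abs]
  have hβT : Integrable (fun x => β (T x)) μ := hβ.comp_measurable hT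
  have hint : Integrable (fun x => (x - T x) ^ 2) μ := (hα.add hβT).congr heq
  have hval : ∫ x, (x - T x) ^ 2 ∂μ = ∫ x, α x ∂μ + ∫ y, β y ∂(μ.map T) := by
    rw [integral_map hT.aemeasurable hβ.aestronglyMeasurable, ← integral_add hα hβT]
    exact integral_congr_ae (heq.mono fun x hx => hx.symm)
  refine le_antisymm ?_ ?_
  · have hpair : Measurable fun x => (x, T x) := measurable_id.prodMk hT
    have h1 : (μ.map fun x => (x, T x)).map Prod.fst = μ := by
      rw [Measure.map_map measurable_fst hpair]
      exact Measure.map_id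
    have h2 : (μ.map fun x => (x, T x)).map Prod.snd = μ.map T := by
      rw [Measure.map_map measurable_snd hpair]
      rfl
    refine (iInf₂_le (μ.map fun x => (x, T x)) ⟨h1, h2⟩).trans (le_of_eq ?_)
    simp only [hedist]
    rw [lintegral_map (by fun_prop) hpair,
      ofReal_integral_eq_lintegral_ofReal hint (Eventually.of_forall fun x => sq_nonneg _)]
  · refine le_iInf₂ fun π hπ => ?_
    obtain ⟨h1, h2⟩ := hπ
    rw [← h1] at hα
    rw [← h2] at hβ
    have i1 : Integrable (fun q : ℝ × ℝ => α q.1) π := hα.comp_measurable measurable_fst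
    have i2 : Integrable (fun q : ℝ × ℝ => β q.2) π := hβ.comp_measurable measurable_snd
    have hi := i1.add i2
    have hv : ∫ x, (x - T x) ^ 2 ∂μ = ∫ q : ℝ × ℝ, α q.1 + β q.2 ∂π := by
      rw [hval, integral_add i1 i2]
      nth_rw 1 [← h1]
      rw [← h2, integral_map measurable_fst.aemeasurable hα.aestronglyMeasurable,
        integral_map measurable_snd.aemeasurable hβ.aestronglyMeasurable]
    rw [← h1] at hle
    have hle' := ae_of_ae_map measurable_fst.aemeasurable hle
    rw [hv]
    calc ENNReal.ofReal (∫ q : ℝ × ℝ, α q.1 + β q.2 ∂π)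
        ≤ ENNReal.ofReal (∫ q : ℝ × ℝ, max (α q.1 + β q.2) 0 ∂π) :=
          ENNReal.ofReal_le_ofReal
            (integral_mono hi hi.pos_part fun q => le_max_left _ _)
      _ = ∫⁻ q : ℝ × ℝ, ENNReal.ofReal (max (α q.1 + β q.2) 0) ∂π :=
          ofReal_integral_eq_lintegral_ofReal hi.pos_part
            (Eventually.of_forall fun q => le_max_right _ _)
      _ ≤ ∫⁻ q : ℝ × ℝ, edist q.1 q.2 ^ 2 ∂π := by
          refine lintegral_mono_ae (hle'.mono fun q hq => ?_)
          rw [hedist]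
          exact ENNReal.ofReal_le_ofReal (max_le (hq q.2) (sq_nonneg _))

/-- Integrating `1_{x ≤ s} (b - y) ≤ 1_{x ≤ s} (b - T s) + (T s - y)⁺` over `s ∈ [a, b]` bounds
`(b - x) (b - y)` by a sum of a function of `x` and one of `y`, with equality for `y = T x` because
`T` is monotone. -/
theorem exists_dual_potentials {a b : ℝ} {T : ℝ → ℝ} (hT : Continuous T)
    (hmono : MonotoneOn T (Icc a b)) :
    ∃ α β : ℝ → ℝ, Continuous α ∧ Continuous β ∧
      (∀ x ∈ Icc a b, ∀ y, α x + β y ≤ (x - y) ^ 2) ∧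
      ∀ x ∈ Icc a b, α x + β (T x) = (x - T x) ^ 2 := by
  have hbT : Continuous fun s => b - T s := by fun_prop
  have hpos : ∀ y, Continuous fun s => max (T s - y) 0 := fun y => by fun_prop
  have hii : ∀ y u v, IntervalIntegrable (fun s => max (T s - y) 0) volume u v :=
    fun y u v => (hpos y).intervalIntegrable u v
  have hi1 : ∀ u v, IntervalIntegrable (fun s => b - T s) volume u v :=
    fun u v => hbT.intervalIntegrable u v
  have hi2 : ∀ y u v, IntervalIntegrable (fun s => T s - y) volume u v :=
    fun y u v => (hT.sub continuous_const).intervalIntegrable u v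
  have hsplit : ∀ x y, (b - x) * (b - y) =
      (∫ s in x..b, b - T s) + ∫ s in x..b, T s - y := fun x y => by
    rw [← intervalIntegral.integral_add (hi1 x b) (hi2 y x b)]
    simp [mul_sub]
  refine ⟨fun x => (b - x) ^ 2 - 2 * ∫ s in x..b, b - T s,
    fun y => (b - y) ^ 2 - 2 * ∫ s in a..b, max (T s - y) 0, ?_, ?_, ?_, ?_⟩
  · have : Continuous fun x => ∫ s in x..b, b - T s := by
      simp_rw [intervalIntegral.integral_symm b]
      exact (intervalIntegral.continuous_primitive hi1 b).neg
    fun_prop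
  · have : Continuous fun y => ∫ s in a..b, max (T s - y) 0 :=
      intervalIntegral.continuous_parametric_intervalIntegral_of_continuous'
        (by fun_prop) a b
    fun_prop
  · intro x hx y
    have h1 : (∫ s in x..b, T s - y) ≤ ∫ s in x..b, max (T s - y) 0 :=
      intervalIntegral.integral_mono_on hx.2 (hi2 y x b) (hii y x b) fun s _ => le_max_left _ _
    have h2 : 0 ≤ ∫ s in a..x, max (T s - y) 0 :=
      intervalIntegral.integral_nonneg hx.1 fun s _ => le_max_right _ _
    have h3 := intervalIntegral.integral_add_adjacent_intervals (hii y a x) (hii y x b)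
    have h4 := hsplit x y
    simp only
    nlinarith
  · intro x hx
    have h1 : (∫ s in x..b, T s - T x) = ∫ s in x..b, max (T s - T x) 0 := by
      refine intervalIntegral.integral_congr fun s hs => ?_
      rw [uIcc_of_le hx.2] at hs
      exact (max_eq_left (sub_nonneg.2 (hmono hx ⟨hx.1.trans hs.1, hs.2⟩ hs.1))).symm
    have h2 : ∫ s in a..x, max (T s - T x) 0 = 0 := by
      rw [intervalIntegral.integral_congr (g := fun _ => (0 : ℝ)) fun s hs => ?_]
      · simp
      rw [uIcc_of_le hx.1] at hs
      exact max_eq_right (sub_nonpos.2 (hmono ⟨hs.1, hs.2.trans hx.2⟩ hx hs.2))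
    have h3 := intervalIntegral.integral_add_adjacent_intervals (hii (T x) a x) (hii (T x) x b)
    have h4 := hsplit x (T x)
    simp only
    nlinarith

/-! ### The transport cost between two densities on an interval -/

theorem densityMeasure_congr {a b : ℝ} {p q : ℝ → ℝ} (h : ∀ x ∈ Icc a b, p x = q x) :
    densityMeasure a b p = densityMeasure a b q := by
  refine withDensity_congr_ae ?_
  filter_upwards [ae_restrict_mem measurableSet_Icc] with x hx
  rw [h x hx]

theorem integral_densityMeasure {a b : ℝ} (hab : a ≤ b) {p : ℝ → ℝ} (hp : Continuous p)
    (h0 : ∀ x, 0 ≤ p x) (f : ℝ → ℝ) :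
    ∫ x, f x ∂(densityMeasure a b p) = ∫ x in a..b, f x * p x := by
  rw [densityMeasure, integral_withDensity_eq_integral_toReal_smul₀ (by fun_prop) (by simp),
    intervalIntegral.integral_of_le hab, integral_Icc_eq_integral_Ioc]
  simp only [ENNReal.toReal_ofReal (h0 _), smul_eq_mul, mul_comm]

theorem isFiniteMeasure_densityMeasure {a b : ℝ} {p : ℝ → ℝ} (hp : Continuous p) :
    IsFiniteMeasure (densityMeasure a b p) :=
  isFiniteMeasure_withDensity_ofReal (hp.integrableOn_Icc).2

theorem ae_densityMeasure {a b : ℝ} {p : ℝ → ℝ} :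
    ∀ᵐ x ∂(densityMeasure a b p), x ∈ Icc a b :=
  (withDensity_absolutelyContinuous _ _).ae_le (ae_restrict_mem measurableSet_Icc)

theorem integrable_densityMeasure {a b : ℝ} {p f : ℝ → ℝ} (hp : Continuous p)
    (hf : Continuous f) : Integrable f (densityMeasure a b p) := by
  have := isFiniteMeasure_densityMeasure (a := a) (b := b) hp
  obtain ⟨C, hC⟩ := isCompact_Icc.exists_bound_of_continuousOn (s := Icc a b) hf.continuousOn
  exact Integrable.of_bound hf.aestronglyMeasurable C (ae_densityMeasure.mono hC)

/-- The monotone rearrangement `T = Q ∘ F`, with `F` the distribution function of `p` and `Q` the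
quantile function of `g`, pushes the one measure to the other. -/
theorem map_densityMeasure {a b : ℝ} (hab : a ≤ b) {p g Q : ℝ → ℝ} (hp : Continuous p)
    (hp0 : ∀ x, 0 ≤ p x) (hp1 : ∫ x in a..b, p x = 1)
    (hg : Continuous g) (hg0 : ∀ x, 0 < g x) (hg1 : ∫ x in a..b, g x = 1)
    (hQ : ∀ x, Q (∫ y in a..x, g y) = x) (hQd : ∀ u, HasDerivAt Q (g (Q u))⁻¹ u) :
    (densityMeasure a b p).map (fun x => Q (∫ y in a..x, p y)) = densityMeasure a b g := by
  set T : ℝ → ℝ := fun x => Q (∫ y in a..x, p y) with hT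
  have hTd : ∀ x, HasDerivAt T ((g (T x))⁻¹ * p x) x := fun x =>
    (hQd _).comp x (hp.integral_hasStrictDerivAt a x).hasDerivAt
  have hTc : Continuous T := continuous_iff_continuousAt.2 fun x => (hTd x).continuousAt
  have hTa : T a = a := by simpa [hT] using hQ a
  have hTb : T b = b := by
    have := hQ b
    rw [hg1] at this
    simp [hT, hp1, this]
  have := isFiniteMeasure_densityMeasure (a := a) (b := b) hp
  have := isFiniteMeasure_densityMeasure (a := a) (b := b) hg
  refine ext_of_forall_integral_eq_of_IsFiniteMeasure fun f => ?_
  rw [integral_map hTc.measurable.aemeasurable f.continuous.aestronglyMeasurable,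
    integral_densityMeasure hab hp hp0, integral_densityMeasure hab hg fun x => (hg0 x).le]
  have hsub := intervalIntegral.integral_comp_mul_deriv (a := a) (b := b)
    (g := fun y => f y * g y) (fun x _ => hTd x)
    ((((hg.comp hTc).inv₀ fun x => (hg0 _).ne').mul hp).continuousOn)
    (f.continuous.mul hg)
  rw [hTa, hTb] at hsub
  rw [← hsub]
  refine intervalIntegral.integral_congr fun x _ => ?_
  have := (hg0 (T x)).ne'
  simp only [Function.comp_apply]
  field_simp

/-- The monotone rearrangement is an optimal transport map. -/
theorem W2_sq_eq {a b : ℝ} (hab : a ≤ b) {p g Q : ℝ → ℝ} (hp : Continuous p)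
    (hp0 : ∀ x, 0 ≤ p x) (hp1 : ∫ x in a..b, p x = 1)
    (hg : Continuous g) (hg0 : ∀ x, 0 < g x) (hg1 : ∫ x in a..b, g x = 1)
    (hQ : ∀ x, Q (∫ y in a..x, g y) = x) (hQd : ∀ u, HasDerivAt Q (g (Q u))⁻¹ u) :
    W2 (densityMeasure a b p) (densityMeasure a b g) ^ 2 =
      ∫ x in a..b, (x - Q (∫ y in a..x, p y)) ^ 2 * p x := by
  have hFd : ∀ x, HasDerivAt (fun x => ∫ y in a..x, p y) (p x) x := fun x =>
    (hp.integral_hasStrictDerivAt a x).hasDerivAt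
  have hF : Continuous fun x => ∫ y in a..x, p y :=
    continuous_iff_continuousAt.2 fun x => (hFd x).continuousAt
  have hFm : Monotone fun x => ∫ y in a..x, p y := monotone_of_hasDerivAt_nonneg hFd hp0
  have hQc : Continuous Q := continuous_iff_continuousAt.2 fun x => (hQd x).continuousAt
  have hQm : Monotone Q := monotone_of_hasDerivAt_nonneg hQd fun u => inv_nonneg.2 (hg0 _).le
  obtain ⟨α, β, hα, hβ, hle, heq⟩ :=
    exists_dual_potentials (a := a) (b := b) (hQc.comp hF) ((hQm.comp hFm).monotoneOn _)
  have hmap := map_densityMeasure hab hp hp0 hp1 hg hg0 hg1 hQ hQd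
  rw [W2, ← hmap, quadraticTransportCost_map_eq (T := fun x => Q (∫ y in a..x, p y))
    (hQc.comp hF).measurable (integrable_densityMeasure hp hα) (hmap ▸ integrable_densityMeasure hg hβ)
    (ae_densityMeasure.mono hle) (ae_densityMeasure.mono heq),
    ENNReal.toReal_ofReal (integral_nonneg fun x => sq_nonneg _),
    Real.sq_sqrt (integral_nonneg fun x => sq_nonneg _), integral_densityMeasure hab hp hp0]

/-- Half the squared distance as an integral in which the density `p` enters only through its
distribution function, and there without derivatives. -/
theorem half_W2_sq_eq {a b : ℝ} (hab : a ≤ b) {p g Q : ℝ → ℝ} (hp : Continuous p)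
    (hp0 : ∀ x, 0 ≤ p x) (hp1 : ∫ x in a..b, p x = 1)
    (hg : Continuous g) (hg0 : ∀ x, 0 < g x) (hg1 : ∫ x in a..b, g x = 1)
    (hQ : ∀ x, Q (∫ y in a..x, g y) = x) (hQd : ∀ u, HasDerivAt Q (g (Q u))⁻¹ u) :
    1 / 2 * W2 (densityMeasure a b p) (densityMeasure a b g) ^ 2 =
      1 / 2 * (∫ y in a..b, (b - y) ^ 2 * g y) +
        ∫ s in a..b, ((b - s) * (∫ y in a..s, p y) -
          ∫ v in (0 : ℝ)..∫ y in a..s, p y, (b - Q v)) := by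
  rw [W2_sq_eq hab hp hp0 hp1 hg hg0 hg1 hQ hQd]
  set F : ℝ → ℝ := fun x => ∫ y in a..x, p y with hFdef
  set ψ : ℝ → ℝ := fun u => ∫ v in (0 : ℝ)..u, (b - Q v) with hψdef
  have hFd : ∀ x, HasDerivAt F (p x) x := fun x =>
    (hp.integral_hasStrictDerivAt a x).hasDerivAt
  have hF : Continuous F := continuous_iff_continuousAt.2 fun x => (hFd x).continuousAt
  have hQc : Continuous Q := continuous_iff_continuousAt.2 fun x => (hQd x).continuousAt
  have hψd : ∀ u, HasDerivAt ψ (b - Q u) u := fun u =>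
    ((continuous_const.sub hQc).integral_hasStrictDerivAt 0 u).hasDerivAt
  have hψ : Continuous ψ := continuous_iff_continuousAt.2 fun x => (hψd x).continuousAt
  have hFa : F a = 0 := by simp [hFdef]
  have hψ0 : ψ 0 = 0 := by simp [hψdef]
  have hmap := map_densityMeasure hab hp hp0 hp1 hg hg0 hg1 hQ hQd
  have e1 : ∫ y in a..b, (b - y) ^ 2 * g y = ∫ x in a..b, (b - Q (F x)) ^ 2 * p x := by
    rw [← integral_densityMeasure hab hg (fun x => (hg0 x).le) fun y => (b - y) ^ 2, ← hmap,
      integral_map (φ := fun x => Q (F x)) (hQc.comp hF).measurable.aemeasurable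
        (by fun_prop : Continuous fun y : ℝ => (b - y) ^ 2).aestronglyMeasurable,
      integral_densityMeasure hab hp hp0]
  -- Expand the square `((b - x) - (b - Q (F x)))²`: the pure second term is a moment of the target,
  -- and the other two are integrated by parts.
  have e2 : ∫ x in a..b, (b - x) ^ 2 * p x = 2 * ∫ x in a..b, (b - x) * F x := by
    rw [intervalIntegral.integral_mul_deriv_eq_deriv_mul (u := fun x => (b - x) ^ 2)
      (u' := fun x => -(2 * (b - x))) (fun x _ => ?_) (fun x _ => hFd x)
      ((by fun_prop : Continuous fun x : ℝ => -(2 * (b - x))).intervalIntegrable _ _)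
      (hp.intervalIntegrable _ _)]
    · rw [← intervalIntegral.integral_const_mul, hFa]
      simp [mul_assoc]
    · refine (((hasDerivAt_id x).const_sub b).pow 2).congr_deriv ?_
      simp
  have e3 : ∫ x in a..b, (b - x) * ((b - Q (F x)) * p x) = ∫ x in a..b, ψ (F x) := by
    rw [intervalIntegral.integral_mul_deriv_eq_deriv_mul (u := fun x => b - x)
      (u' := fun _ => -1) (v := fun x => ψ (F x)) (fun x _ => (hasDerivAt_id x).const_sub b)
      (fun x _ => (hψd _).comp x (hFd x)) (by simp)
      ((by fun_prop : Continuous fun x => (b - Q (F x)) * p x).intervalIntegrable _ _)]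
    simp [hFa, hψ0]
  have i1 : IntervalIntegrable (fun x => (b - x) ^ 2 * p x) volume a b :=
    (by fun_prop : Continuous fun x => (b - x) ^ 2 * p x).intervalIntegrable _ _
  have i2 : IntervalIntegrable (fun x => (b - Q (F x)) ^ 2 * p x) volume a b :=
    (by fun_prop : Continuous fun x => (b - Q (F x)) ^ 2 * p x).intervalIntegrable _ _
  have i3 : IntervalIntegrable (fun x => (b - x) * ((b - Q (F x)) * p x)) volume a b :=
    (by fun_prop : Continuous fun x => (b - x) * ((b - Q (F x)) * p x)).intervalIntegrable _ _
  have e4 : ∫ x in a..b, (x - Q (F x)) ^ 2 * p x =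
      (∫ x in a..b, (b - x) ^ 2 * p x) + (∫ x in a..b, (b - Q (F x)) ^ 2 * p x) -
        2 * ∫ x in a..b, (b - x) * ((b - Q (F x)) * p x) := by
    rw [← intervalIntegral.integral_const_mul, ← intervalIntegral.integral_add i1 i2,
      ← intervalIntegral.integral_sub (i1.add i2) (i3.const_mul 2)]
    refine intervalIntegral.integral_congr fun x _ => ?_
    ring
  have e5 : ∫ s in a..b, ((b - s) * F s - ψ (F s)) =
      (∫ s in a..b, (b - s) * F s) - ∫ s in a..b, ψ (F s) :=
    intervalIntegral.integral_sub
      ((by fun_prop : Continuous fun s => (b - s) * F s).intervalIntegrable _ _)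
      ((hψ.comp hF).intervalIntegrable _ _)
  change 1 / 2 * ∫ x in a..b, (x - Q (F x)) ^ 2 * p x = _ + ∫ s in a..b, ((b - s) * F s - ψ (F s))
  rw [e4, e5, e1, e2, e3]
  ring

/-! ### Regularity of the model -/

/-- The extension is constant on either side of `[a, b]`, which keeps a positive lower bound. -/
theorem exists_continuous_extension {a b : ℝ} (hab : a ≤ b) {f : ℝ → ℝ}
    (hf : ContinuousOn f (Icc a b)) (hpos : ∀ x ∈ Icc a b, 0 < f x) :
    ∃ g : ℝ → ℝ, Continuous g ∧ (∃ m, 0 < m ∧ ∀ x, m ≤ g x) ∧ ∀ x ∈ Icc a b, g x = f x := by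
  obtain ⟨z, hz, hmin⟩ := isCompact_Icc.exists_isMinOn (nonempty_Icc.2 hab) hf
  refine ⟨fun x => f (projIcc a b hab x), ?_, ⟨f z, hpos z hz, fun x => ?_⟩, fun x hx => ?_⟩
  · exact hf.comp_continuous (continuous_subtype_val.comp continuous_projIcc) fun x =>
      (projIcc a b hab x).2
  · exact hmin (projIcc a b hab x).2
  · simp [projIcc_of_mem hab hx]

theorem contDiffAt_partialDeriv {d : ℕ} {n : ℕ} {f : EuclideanSpace ℝ (Fin d) → ℝ}
    {θ : EuclideanSpace ℝ (Fin d)} (hf : ContDiffAt ℝ (n + 1 : ℕ) f θ) (i : Fin d) :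
    ContDiffAt ℝ n (partialDeriv i f) θ :=
  (hf.fderiv_right (m := (n : ℕ)) (by norm_cast)).clm_apply contDiffAt_const

section Model

variable {d : ℕ} {a b : ℝ} {Θ : Set (EuclideanSpace ℝ (Fin d))}
  {ρ : ℝ → EuclideanSpace ℝ (Fin d) → ℝ} {θ : EuclideanSpace ℝ (Fin d)} {x : ℝ}

theorem cdf_eq_integral {p : ℝ → ℝ} (hp : ∀ y ∈ Icc a b, p y = ρ y θ) (hx : x ∈ Icc a b) :
    cdf a ρ x θ = ∫ y in a..x, p y := by
  refine intervalIntegral.integral_congr fun y hy => ?_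
  rw [uIcc_of_le hx.1] at hy
  exact (hp y ⟨hy.1, hy.2.trans hx.2⟩).symm

theorem IsStatisticalModel.continuousOn_density (hρ : IsStatisticalModel a b Θ ρ) (hθ : θ ∈ Θ) :
    ContinuousOn (fun x => ρ x θ) (Icc a b) :=
  (hρ.smooth θ hθ).continuousOn

theorem IsStatisticalModel.cdf_right (hab : a ≤ b) (hρ : IsStatisticalModel a b Θ ρ)
    (hθ : θ ∈ Θ) : cdf a ρ b θ = 1 := by
  rw [cdf, intervalIntegral.integral_of_le hab, ← integral_Icc_eq_integral_Ioc]
  exact hρ.integral_eq_one θ hθ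

theorem IsStatisticalModel.continuousOn_cdf (hab : a ≤ b) (hρ : IsStatisticalModel a b Θ ρ)
    (hθ : θ ∈ Θ) : ContinuousOn (fun x => cdf a ρ x θ) (Icc a b) := by
  obtain ⟨p, hp, -, hpρ⟩ := exists_continuous_extension hab (hρ.continuousOn_density hθ)
    (hρ.pos θ hθ)
  refine ContinuousOn.congr (f := fun x => ∫ y in a..x, p y) ?_ fun x hx =>
    cdf_eq_integral hpρ hx
  exact (intervalIntegral.continuous_primitive
    (fun u v => hp.intervalIntegrable u v) a).continuousOn

theorem IsStatisticalModel.cdf_mem_Icc (hab : a ≤ b) (hρ : IsStatisticalModel a b Θ ρ)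
    (hθ : θ ∈ Θ) (hx : x ∈ Icc a b) : cdf a ρ x θ ∈ Icc (0 : ℝ) 1 := by
  have hint : IntervalIntegrable (fun y => ρ y θ) volume a b :=
    ContinuousOn.intervalIntegrable (by
      rw [uIcc_of_le hab]
      exact hρ.continuousOn_density hθ)
  have h0 : ∀ y ∈ Icc a b, 0 ≤ ρ y θ := fun y hy => (hρ.pos θ hθ y hy).le
  have hax := hint.mono_set (c := a) (d := x)
    (by rw [uIcc_of_le hx.1, uIcc_of_le hab]; exact Icc_subset_Icc_right hx.2)
  have hxb := hint.mono_set (c := x) (d := b)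
    (by rw [uIcc_of_le hx.2, uIcc_of_le hab]; exact Icc_subset_Icc_left hx.1)
  have hsum := intervalIntegral.integral_add_adjacent_intervals hax hxb
  have h1 : 0 ≤ ∫ y in a..x, ρ y θ := intervalIntegral.integral_nonneg hx.1 fun y hy =>
    h0 y ⟨hy.1, hy.2.trans hx.2⟩
  have h2 : 0 ≤ ∫ y in x..b, ρ y θ := intervalIntegral.integral_nonneg hx.2 fun y hy =>
    h0 y ⟨hx.1.trans hy.1, hy.2⟩
  have h3 := hρ.cdf_right hab hθ
  simp only [cdf] at h3 ⊢
  constructor <;> linarith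

theorem IsStatisticalModel.contDiffAt_density (hΘ : IsOpen Θ) (hρ : IsStatisticalModel a b Θ ρ)
    (hθ : θ ∈ Θ) (hx : x ∈ Icc a b) : ContDiffAt ℝ 1 (ρ x) θ :=
  (hρ.density_contDiffOn x hx).contDiffAt (hΘ.mem_nhds hθ)

theorem IsStatisticalModel.contDiffAt_cdf (hΘ : IsOpen Θ) (hρ : IsStatisticalModel a b Θ ρ)
    (hθ : θ ∈ Θ) (hx : x ∈ Icc a b) : ContDiffAt ℝ 2 (cdf a ρ x) θ :=
  (hρ.cdf_contDiffOn x hx).contDiffAt (hΘ.mem_nhds hθ)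

theorem IsStatisticalModel.differentiableAt_cdf (hΘ : IsOpen Θ)
    (hρ : IsStatisticalModel a b Θ ρ) (hθ : θ ∈ Θ) (hx : x ∈ Icc a b) :
    DifferentiableAt ℝ (cdf a ρ x) θ :=
  (hρ.contDiffAt_cdf hΘ hθ hx).differentiableAt (by simp)

theorem IsStatisticalModel.contDiffAt_partialDeriv_cdf (hΘ : IsOpen Θ)
    (hρ : IsStatisticalModel a b Θ ρ) (hθ : θ ∈ Θ) (hx : x ∈ Icc a b) (i : Fin d) :
    ContDiffAt ℝ 1 (partialDeriv i (cdf a ρ x)) θ :=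
  contDiffAt_partialDeriv (n := 1) (hρ.contDiffAt_cdf hΘ hθ hx) i

theorem IsStatisticalModel.differentiableAt_partialDeriv_cdf (hΘ : IsOpen Θ)
    (hρ : IsStatisticalModel a b Θ ρ) (hθ : θ ∈ Θ) (hx : x ∈ Icc a b) (i : Fin d) :
    DifferentiableAt ℝ (partialDeriv i (cdf a ρ x)) θ :=
  (hρ.contDiffAt_partialDeriv_cdf hΘ hθ hx i).differentiableAt (by simp)

theorem IsStatisticalModel.continuousAt_partialDeriv_partialDeriv_cdf (hΘ : IsOpen Θ)
    (hρ : IsStatisticalModel a b Θ ρ) (hθ : θ ∈ Θ) (hx : x ∈ Icc a b) (i j : Fin d) :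
    ContinuousAt (partialDeriv i (partialDeriv j (cdf a ρ x))) θ :=
  (contDiffAt_partialDeriv (n := 0) (hρ.contDiffAt_partialDeriv_cdf hΘ hθ hx j) i).continuousAt

theorem IsStatisticalModel.aestronglyMeasurable_cdf (hab : a ≤ b)
    (hρ : IsStatisticalModel a b Θ ρ) (hθ : θ ∈ Θ) :
    AEStronglyMeasurable (fun x => cdf a ρ x θ) (volume.restrict (Icc a b)) :=
  (hρ.continuousOn_cdf hab hθ).aestronglyMeasurable measurableSet_Icc

theorem IsStatisticalModel.aestronglyMeasurable_partialDeriv_cdf (hab : a ≤ b) (hΘ : IsOpen Θ)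
    (hρ : IsStatisticalModel a b Θ ρ) (hθ : θ ∈ Θ) (i : Fin d) :
    AEStronglyMeasurable (fun x => partialDeriv i (cdf a ρ x) θ) (volume.restrict (Icc a b)) :=
  aestronglyMeasurable_partialDeriv i
    (eventually_of_mem (hΘ.mem_nhds hθ) fun _ hη => hρ.aestronglyMeasurable_cdf hab hη)
    ((ae_restrict_mem measurableSet_Icc).mono fun _ hs => hρ.differentiableAt_cdf hΘ hθ hs)

theorem IsStatisticalModel.aestronglyMeasurable_partialDeriv_partialDeriv_cdf (hab : a ≤ b)
    (hΘ : IsOpen Θ) (hρ : IsStatisticalModel a b Θ ρ) (hθ : θ ∈ Θ) (i j : Fin d) :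
    AEStronglyMeasurable (fun x => partialDeriv i (partialDeriv j (cdf a ρ x)) θ)
      (volume.restrict (Icc a b)) :=
  aestronglyMeasurable_partialDeriv i
    (eventually_of_mem (hΘ.mem_nhds hθ) fun _ hη =>
      hρ.aestronglyMeasurable_partialDeriv_cdf hab hΘ hη j)
    ((ae_restrict_mem measurableSet_Icc).mono fun _ hs =>
      hρ.differentiableAt_partialDeriv_cdf hΘ hθ hs j)

theorem HasIntegrableMax.mono {N N' : Set (EuclideanSpace ℝ (Fin d))}
    {h : ℝ → EuclideanSpace ℝ (Fin d) → ℝ} (hh : HasIntegrableMax a b N h) (hN : N' ⊆ N) :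
    HasIntegrableMax a b N' h := by
  obtain ⟨g, hg, hle⟩ := hh
  exact ⟨g, hg, hle.mono fun x hx η hη => hx η (hN hη)⟩

/-- The domination of `∇_θ ρ` allows to differentiate the distribution function under the integral
sign. -/
theorem partialDeriv_cdf_eq_integral (hΘ : IsOpen Θ)
    (hρ : IsStatisticalModel a b Θ ρ) {N : Set (EuclideanSpace ℝ (Fin d))} (hN : N ∈ 𝓝 θ)
    (hNΘ : N ⊆ Θ) (hmax : ∀ i, HasIntegrableMax a b N fun x η => partialDeriv i (ρ x) η)
    (hx : x ∈ Icc a b) (i : Fin d) :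
    partialDeriv i (cdf a ρ x) θ = ∫ y in a..x, partialDeriv i (ρ y) θ := by
  have hsub : Ioc a x ⊆ Icc a b := fun y hy => ⟨hy.1.le, hy.2.trans hx.2⟩
  have hc : ∀ η ∈ N, ContinuousOn (fun y => ρ y η) (Icc a b) := fun η hη =>
    hρ.continuousOn_density (hNΘ hη)
  have key := (differentiableAt_integral_of_partialDeriv_le (μ := volume.restrict (Ioc a x))
    (f := ρ) hN
    (fun η hη => ((hc η hη).mono hsub).aestronglyMeasurable measurableSet_Ioc)
    (((hc θ (mem_of_mem_nhds hN)).integrableOn_Icc).mono_set hsub)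
    ((ae_restrict_mem measurableSet_Ioc).mono fun s hs η hη =>
      (hρ.contDiffAt_density hΘ (hNΘ hη) (hsub hs)).differentiableAt (by simp))
    fun i => by
      obtain ⟨g, hg, hle⟩ := hmax i
      exact ⟨g, hg.mono_set hsub, ae_restrict_of_ae_restrict_of_subset hsub hle⟩).2 i
  have hcdf : cdf a ρ x = fun η => ∫ y in Ioc a x, ρ y η :=
    funext fun η => intervalIntegral.integral_of_le hx.1
  rw [hcdf, key, intervalIntegral.integral_of_le hx.1]

/-- The domination assumption on an open neighbourhood, with `∇_θ F` bounded by a constant there: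
this follows from the integrable majorant of `∇_θ ρ`. -/
theorem DominationAssumption.exists_isOpen (hΘ : IsOpen Θ)
    (hρ : IsStatisticalModel a b Θ ρ) (hdom : DominationAssumption a b Θ ρ) (hθ : θ ∈ Θ) :
    ∃ N : Set (EuclideanSpace ℝ (Fin d)), IsOpen N ∧ θ ∈ N ∧ N ⊆ Θ ∧
      (∀ η ∈ N, ∀ x ∈ Icc a b, ∀ i,
        partialDeriv i (cdf a ρ x) η = ∫ y in a..x, partialDeriv i (ρ y) η) ∧
      (∃ M : ℝ, ∀ η ∈ N, ∀ x ∈ Icc a b, ∀ i, |partialDeriv i (cdf a ρ x) η| ≤ M) ∧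
      ∀ i j : Fin d,
        HasIntegrableMax a b N (fun x θ => partialDeriv i (partialDeriv j (cdf a ρ x)) θ) ∧
        HasIntegrableMax a b N (fun x θ =>
          1 / ρ x θ * |partialDeriv i (cdf a ρ x) θ * partialDeriv j (cdf a ρ x) θ|) := by
  obtain ⟨N₀, hN₀, hN₀Θ, hN₀d⟩ := hdom θ hθ
  have hsub : interior N₀ ⊆ N₀ := interior_subset
  have hmax : ∀ i, HasIntegrableMax a b (interior N₀) fun x η => partialDeriv i (ρ x) η :=
    fun i => (hN₀d i i).2.1.mono hsub
  have heq : ∀ η ∈ interior N₀, ∀ x ∈ Icc a b, ∀ i,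
      partialDeriv i (cdf a ρ x) η = ∫ y in a..x, partialDeriv i (ρ y) η :=
    fun η hη x hx i => partialDeriv_cdf_eq_integral hΘ hρ (isOpen_interior.mem_nhds hη)
      (hsub.trans hN₀Θ) hmax hx i
  refine ⟨interior N₀, isOpen_interior, mem_interior_iff_mem_nhds.2 hN₀, hsub.trans hN₀Θ, heq, ?_,
    fun i j => ⟨(hN₀d i j).1.mono hsub, (hN₀d i j).2.2.mono hsub⟩⟩
  choose g hg hgle using hmax
  -- Since `F` is a primitive of `ρ`, the total mass of a majorant of `∂_i ρ` bounds `∂_i F`.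
  refine ⟨∑ i, ∫ y in Icc a b, |g i y|, fun η hη x hx i => ?_⟩
  have hsubx : Ioc a x ⊆ Icc a b := fun y hy => ⟨hy.1.le, hy.2.trans hx.2⟩
  have habs : IntegrableOn (fun y => |g i y|) (Icc a b) := (hg i).abs
  rw [heq η hη x hx i, intervalIntegral.integral_of_le hx.1, ← Real.norm_eq_abs]
  calc ‖∫ y in Ioc a x, partialDeriv i (ρ y) η‖
      ≤ ∫ y in Ioc a x, |g i y| := by
        refine norm_integral_le_of_norm_le (habs.mono_set hsubx) ?_
        filter_upwards [ae_restrict_of_ae_restrict_of_subset hsubx (hgle i)] with y hy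
        exact (hy η hη).trans (le_abs_self _)
    _ ≤ ∫ y in Icc a b, |g i y| :=
        setIntegral_mono_set habs (Eventually.of_forall fun y => abs_nonneg _)
          hsubx.eventuallyLE
    _ ≤ ∑ i, ∫ y in Icc a b, |g i y| :=
        Finset.single_le_sum (f := fun i => ∫ y in Icc a b, |g i y|)
          (fun i _ => integral_nonneg fun y => abs_nonneg _) (Finset.mem_univ i)

/-! ### The metric tensor in terms of the distribution function -/

/-- Integrating the Neumann problem from `a` to `x`. -/
theorem IsPotential.density_mul_derivWithin (hab : a < b) (hρ : IsStatisticalModel a b Θ ρ)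
    (hθ : θ ∈ Θ) {ξ : EuclideanSpace ℝ (Fin d)} {Φ : ℝ → ℝ} (hΦ : IsPotential a b ρ θ ξ Φ)
    (hx : x ∈ Icc a b) :
    ρ x θ * derivWithin Φ (Icc a b) x = -∫ y in a..x, fderiv ℝ (ρ y) θ ξ := by
  set u : ℝ → ℝ := fun y => ρ y θ * derivWithin Φ (Icc a b) y with hu
  have hud : UniqueDiffOn ℝ (Icc a b) := uniqueDiffOn_Icc hab
  have hu1 : ContDiffOn ℝ 1 u (Icc a b) :=
    ((hρ.smooth θ hθ).of_le (by norm_cast)).mul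
      (hΦ.smooth.derivWithin hud (by norm_cast))
  have hu' : ContinuousOn (derivWithin u (Icc a b)) (Icc a b) :=
    hu1.continuousOn_derivWithin hud le_rfl
  have hsub : Icc a x ⊆ Icc a b := Icc_subset_Icc_right hx.2
  have hftc := intervalIntegral.integral_eq_sub_of_hasDerivAt_of_le hx.1
    (f := u) (f' := derivWithin u (Icc a b)) (hu1.continuousOn.mono hsub)
    (fun y hy => by
      have hy' : y ∈ Ioo a b := ⟨hy.1, hy.2.trans_le hx.2⟩
      exact ((hu1.differentiableOn (by simp)) y
        (Ioo_subset_Icc_self hy')).hasDerivWithinAt.hasDerivAt (Icc_mem_nhds hy'.1 hy'.2))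
    (ContinuousOn.intervalIntegrable (by rw [uIcc_of_le hx.1]; exact hu'.mono hsub))
  have hua : u a = 0 := by simp [hu, hΦ.neumann_left]
  have heq : ∫ y in a..x, fderiv ℝ (ρ y) θ ξ = ∫ y in a..x, -derivWithin u (Icc a b) y := by
    refine intervalIntegral.integral_congr fun y hy => ?_
    rw [uIcc_of_le hx.1] at hy
    exact (hΦ.equation y (hsub hy)).symm
  rw [heq, intervalIntegral.integral_neg, hftc, hua]
  simp [hu]

/-- By the integrated Neumann problem `∂_i F = -ρ Φ_i'`, and the two integrands agree. -/
theorem metricMatrix_eq_cdfMatrix (hab : a < b) (hΘ : IsOpen Θ)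
    (hρ : IsStatisticalModel a b Θ ρ) (hell : EllipticAssumption a b Θ ρ)
    (hdom : DominationAssumption a b Θ ρ) (hθ : θ ∈ Θ) :
    metricMatrix a b ρ θ = cdfMatrix a b ρ θ := by
  obtain ⟨N, -, hθN, -, heq, -⟩ := hdom.exists_isOpen hΘ hρ hθ
  ext i j
  obtain ⟨Φ, hΦ⟩ := hell θ hθ (EuclideanSpace.single i 1)
  obtain ⟨Ψ, hΨ⟩ := hell θ hθ (EuclideanSpace.single j 1)
  simp only [metricMatrix, cdfMatrix, Matrix.of_apply]
  rw [metricTensor_eq hab hρ hθ hΦ hΨ]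
  refine setIntegral_congr_fun measurableSet_Icc fun x hx => ?_
  have h1 := neg_eq_iff_eq_neg.2 (hΦ.density_mul_derivWithin hab hρ hθ hx)
  have h2 := neg_eq_iff_eq_neg.2 (hΨ.density_mul_derivWithin hab hρ hθ hx)
  have h0 := (hρ.pos θ hθ x hx).ne'
  simp only [cdfIntegrand]
  rw [heq θ hθN x hx i, heq θ hθN x hx j]
  change _ = 1 / ρ x θ * ((∫ y in a..x, fderiv ℝ (ρ y) θ (EuclideanSpace.single i 1)) *
    ∫ y in a..x, fderiv ℝ (ρ y) θ (EuclideanSpace.single j 1))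
  rw [← h1, ← h2]
  field_simp

/-- Both claims rest on the integrable majorant of `∇_θ F ⊗ ∇_θ F / ρ`. -/
theorem integrableOn_cdfIntegrand_and_tendsto_cdfMatrix (hab : a ≤ b) (hΘ : IsOpen Θ)
    (hρ : IsStatisticalModel a b Θ ρ) (hdom : DominationAssumption a b Θ ρ) (hθ : θ ∈ Θ) :
    (∀ i j, IntegrableOn (cdfIntegrand a ρ θ i j) (Icc a b)) ∧
      Tendsto (cdfMatrix a b ρ) (𝓝 θ) (𝓝 (cdfMatrix a b ρ θ)) := by
  obtain ⟨N, hNo, hθN, hNΘ, -, -, hmax⟩ := hdom.exists_isOpen hΘ hρ hθ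
  have hmeas : ∀ η ∈ Θ, ∀ i j,
      AEStronglyMeasurable (cdfIntegrand a ρ η i j) (volume.restrict (Icc a b)) :=
    fun η hη i j => AEStronglyMeasurable.mul
      ((continuousOn_const.div (hρ.continuousOn_density hη)
        fun x hx => (hρ.pos η hη x hx).ne').aestronglyMeasurable measurableSet_Icc)
      ((hρ.aestronglyMeasurable_partialDeriv_cdf hab hΘ hη i).mul
        (hρ.aestronglyMeasurable_partialDeriv_cdf hab hΘ hη j))
  have hbound : ∀ i j, ∃ g : ℝ → ℝ, IntegrableOn g (Icc a b) ∧
      ∀ᵐ x ∂(volume.restrict (Icc a b)), ∀ η ∈ N, ‖cdfIntegrand a ρ η i j x‖ ≤ g x := by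
    intro i j
    obtain ⟨g, hg, hle⟩ := (hmax i j).2
    refine ⟨g, hg, ?_⟩
    filter_upwards [hle, ae_restrict_mem measurableSet_Icc] with x hx hxm η hη
    have h := hx η hη
    have h0 : 0 ≤ 1 / ρ x η := (one_div_pos.2 (hρ.pos η (hNΘ hη) x hxm)).le
    rwa [abs_mul, abs_abs, ← abs_mul] at h
  refine ⟨fun i j => ?_, ?_⟩
  · obtain ⟨g, hg, hle⟩ := hbound i j
    exact Integrable.mono' hg (hmeas θ hθ i j) (hle.mono fun x hx => hx θ hθN)
  · refine tendsto_pi_nhds.2 fun i => tendsto_pi_nhds.2 fun j => ?_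
    obtain ⟨g, hg, hle⟩ := hbound i j
    refine tendsto_integral_filter_of_dominated_convergence g
      (eventually_of_mem (hΘ.mem_nhds hθ) fun η hη => hmeas η hη i j)
      (eventually_of_mem (hNo.mem_nhds hθN) fun η hη => hle.mono fun x hx => hx η hη) hg ?_
    filter_upwards [ae_restrict_mem measurableSet_Icc] with x hx
    exact (tendsto_const_nhds.div (hρ.contDiffAt_density hΘ hθ hx).continuousAt
      (hρ.pos θ hθ x hx).ne').mul
      ((hρ.contDiffAt_partialDeriv_cdf hΘ hθ hx i).continuousAt.mul
        (hρ.contDiffAt_partialDeriv_cdf hΘ hθ hx j).continuousAt)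

end Model

/-! ### The objective function and its derivatives -/

section Objective

variable {d : ℕ} {a b : ℝ} {Θ : Set (EuclideanSpace ℝ (Fin d))}
  {ρ : ℝ → EuclideanSpace ℝ (Fin d) → ℝ} {θ : EuclideanSpace ℝ (Fin d)}

/-- The objective function in terms of the distribution functions. Here `g` is a positive continuous
extension of the target density to the line and `Q` its quantile function. -/
theorem exists_objective_eq (hab : a ≤ b) (hρ : IsStatisticalModel a b Θ ρ)
    {θstar : EuclideanSpace ℝ (Fin d)} (hθstar : θstar ∈ Θ) {ρstar : ℝ → ℝ}
    (hρstar : ∀ x ∈ Icc a b, ρstar x = ρ x θstar) :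
    ∃ (g Q : ℝ → ℝ) (C : ℝ), Continuous g ∧ (∃ m, 0 < m ∧ ∀ x, m ≤ g x) ∧
      (∀ x ∈ Icc a b, g x = ρ x θstar) ∧ (∀ u, HasDerivAt Q (g (Q u))⁻¹ u) ∧
      (∀ x ∈ Icc a b, Q (cdf a ρ x θstar) = x) ∧
      ∀ θ ∈ Θ, objective a b ρ ρstar θ = C + ∫ s in Icc a b, ((b - s) * cdf a ρ s θ -
        ∫ v in (0 : ℝ)..cdf a ρ s θ, (b - Q v)) := by
  obtain ⟨g, hg, ⟨m, hm, hgm⟩, hgρ⟩ := exists_continuous_extension hab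
    (hρ.continuousOn_density hθstar) (hρ.pos θstar hθstar)
  obtain ⟨Q, hQ, hQd⟩ := exists_quantile a hg hm hgm
  have hb : b ∈ Icc a b := right_mem_Icc.2 hab
  refine ⟨g, Q, 1 / 2 * ∫ y in a..b, (b - y) ^ 2 * g y, hg, ⟨m, hm, hgm⟩, hgρ, hQd,
    fun x hx => ?_, fun θ hθ => ?_⟩
  · rw [cdf_eq_integral hgρ hx, hQ]
  · obtain ⟨p, hp, ⟨m', hm', hpm⟩, hpρ⟩ := exists_continuous_extension hab
      (hρ.continuousOn_density hθ) (hρ.pos θ hθ)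
    have h := half_W2_sq_eq hab hp (fun x => hm'.le.trans (hpm x))
      (by rw [← cdf_eq_integral hpρ hb]; exact hρ.cdf_right hab hθ) hg
      (fun x => hm.trans_le (hgm x))
      (by rw [← cdf_eq_integral hgρ hb]; exact hρ.cdf_right hab hθstar) hQ hQd
    rw [objective, ← densityMeasure_congr hpρ,
      densityMeasure_congr fun x hx => (hρstar x hx).trans (hgρ x hx).symm, h,
      integral_Icc_eq_integral_Ioc, ← intervalIntegral.integral_of_le hab]
    congr 1
    refine intervalIntegral.integral_congr fun s hs => ?_
    rw [uIcc_of_le hab] at hs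
    simp only [cdf_eq_integral hpρ hs]

/-- The integrand of the Hessian of the objective function: the first summand vanishes at the target
parameter, where `Q` inverts the distribution function. -/
noncomputable def hessianIntegrand (a : ℝ) (ρ : ℝ → EuclideanSpace ℝ (Fin d) → ℝ) (g Q : ℝ → ℝ)
    (θ : EuclideanSpace ℝ (Fin d)) (i j : Fin d) (s : ℝ) : ℝ :=
  (Q (cdf a ρ s θ) - s) * partialDeriv i (partialDeriv j (cdf a ρ s)) θ +
    partialDeriv j (cdf a ρ s) θ * ((g (Q (cdf a ρ s θ)))⁻¹ * partialDeriv i (cdf a ρ s) θ)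

section

variable {g Q : ℝ → ℝ}

theorem partialDeriv_quantile_mul (hΘ : IsOpen Θ) (hρ : IsStatisticalModel a b Θ ρ)
    (hQd : ∀ u, HasDerivAt Q (g (Q u))⁻¹ u) (hθ : θ ∈ Θ) {s : ℝ} (hs : s ∈ Icc a b)
    (i j : Fin d) :
    DifferentiableAt ℝ (fun η => (Q (cdf a ρ s η) - s) * partialDeriv j (cdf a ρ s) η) θ ∧
    partialDeriv i (fun η => (Q (cdf a ρ s η) - s) * partialDeriv j (cdf a ρ s) η) θ =
      hessianIntegrand a ρ g Q θ i j s := by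
  have hF := hρ.differentiableAt_cdf hΘ hθ hs
  have hQs : HasDerivAt (fun u => Q u - s) (g (Q (cdf a ρ s θ)))⁻¹ (cdf a ρ s θ) :=
    (hQd _).sub_const s
  have h1 : DifferentiableAt ℝ (fun η => Q (cdf a ρ s η) - s) θ :=
    (hQs.comp_hasFDerivAt θ hF.hasFDerivAt).differentiableAt
  have h2 := hρ.differentiableAt_partialDeriv_cdf hΘ hθ hs j
  refine ⟨h1.mul h2, ?_⟩
  rw [partialDeriv_mul i h1 h2, partialDeriv_comp i hQs hF, hessianIntegrand]

theorem aestronglyMeasurable_quantile_mul (hab : a ≤ b) (hΘ : IsOpen Θ)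
    (hρ : IsStatisticalModel a b Θ ρ) (hQ : Continuous Q) (hθ : θ ∈ Θ) (j : Fin d) :
    AEStronglyMeasurable (fun s => (Q (cdf a ρ s θ) - s) * partialDeriv j (cdf a ρ s) θ)
      (volume.restrict (Icc a b)) :=
  ((hQ.comp_aestronglyMeasurable (hρ.aestronglyMeasurable_cdf hab hθ)).sub
    continuous_id.aestronglyMeasurable).mul
    (hρ.aestronglyMeasurable_partialDeriv_cdf hab hΘ hθ j)

/-- `Q ∘ F - id` is bounded, since `F` takes values in `[0, 1]`. -/
theorem exists_quantile_sub_bound (hab : a ≤ b) (hρ : IsStatisticalModel a b Θ ρ)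
    (hQ : Continuous Q) :
    ∃ K : ℝ, ∀ θ ∈ Θ, ∀ s ∈ Icc a b, |Q (cdf a ρ s θ) - s| ≤ K := by
  obtain ⟨K, hK⟩ := (isCompact_Icc.prod isCompact_Icc).exists_bound_of_continuousOn
    (s := Icc (0 : ℝ) 1 ×ˢ Icc a b) (f := fun q : ℝ × ℝ => Q q.1 - q.2)
    (by fun_prop)
  exact ⟨K, fun θ hθ s hs => hK (cdf a ρ s θ, s) ⟨hρ.cdf_mem_Icc hab hθ hs, hs⟩⟩

/-- The majorant for the Hessian needs no hypothesis on `∇_θ F ⊗ ∇_θ F / ρ`: `∇_θ F` is locally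
bounded, and the target density is bounded below. -/
theorem exists_hessianIntegrand_bound (hab : a ≤ b) (hΘ : IsOpen Θ)
    (hρ : IsStatisticalModel a b Θ ρ) (hdom : DominationAssumption a b Θ ρ)
    (hQ : Continuous Q) {m : ℝ} (hm : 0 < m) (hgm : ∀ x, m ≤ g x) (hθ : θ ∈ Θ) :
    ∃ N : Set (EuclideanSpace ℝ (Fin d)), IsOpen N ∧ θ ∈ N ∧ N ⊆ Θ ∧
      (∃ M : ℝ, ∀ η ∈ N, ∀ s ∈ Icc a b, ∀ i,
        |(Q (cdf a ρ s η) - s) * partialDeriv i (cdf a ρ s) η| ≤ M) ∧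
      ∀ i j, HasIntegrableMax a b N fun s η => hessianIntegrand a ρ g Q η i j s := by
  obtain ⟨N, hNo, hθN, hNΘ, -, ⟨M, hM⟩, hmax⟩ := hdom.exists_isOpen hΘ hρ hθ
  obtain ⟨K, hK⟩ := exists_quantile_sub_bound hab hρ hQ
  refine ⟨N, hNo, hθN, hNΘ, ⟨K * M, fun η hη s hs i => ?_⟩, fun i j => ?_⟩
  · rw [abs_mul]
    exact mul_le_mul (hK η (hNΘ hη) s hs) (hM η hη s hs i) (abs_nonneg _)
      ((abs_nonneg _).trans (hK η (hNΘ hη) s hs))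
  · obtain ⟨k, hk, hle⟩ := (hmax i j).1
    refine ⟨fun s => K * k s + M * (m⁻¹ * M), (hk.const_mul K).add (integrable_const _), ?_⟩
    filter_upwards [hle, ae_restrict_mem measurableSet_Icc] with s hs hsm η hη
    have hK0 := hK η (hNΘ hη) s hsm
    have hM0 : 0 ≤ M := (abs_nonneg _).trans (hM η hη s hsm i)
    refine (abs_add_le _ _).trans (add_le_add ?_ ?_)
    · rw [abs_mul]
      exact mul_le_mul hK0 (hs η hη) (abs_nonneg _) ((abs_nonneg _).trans hK0)
    · rw [abs_mul, abs_mul, abs_inv, abs_of_pos (hm.trans_le (hgm _))]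
      exact mul_le_mul (hM η hη s hsm j)
        (mul_le_mul (inv_anti₀ hm (hgm _)) (hM η hη s hsm i) (abs_nonneg _)
          (inv_nonneg.2 hm.le)) (by have := hm.trans_le (hgm (Q (cdf a ρ s η))); positivity) hM0

/-- First and second derivatives of a function of the form of the objective function. -/
theorem derivatives_of_eq_integral (hab : a ≤ b) (hΘ : IsOpen Θ)
    (hρ : IsStatisticalModel a b Θ ρ) (hdom : DominationAssumption a b Θ ρ)
    {m : ℝ} (hm : 0 < m) (hgm : ∀ x, m ≤ g x)
    (hQd : ∀ u, HasDerivAt Q (g (Q u))⁻¹ u) {R : EuclideanSpace ℝ (Fin d) → ℝ} {C : ℝ}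
    (hR : ∀ θ ∈ Θ, R θ = C + ∫ s in Icc a b, ((b - s) * cdf a ρ s θ -
        ∫ v in (0 : ℝ)..cdf a ρ s θ, (b - Q v))) :
    DifferentiableOn ℝ R Θ ∧ DifferentiableOn ℝ (fderiv ℝ R) Θ ∧
      ∀ θ ∈ Θ, ∀ i j, hessianMatrix R θ i j = ∫ s in Icc a b, hessianIntegrand a ρ g Q θ i j s := by
  have hQ : Continuous Q := continuous_iff_continuousAt.2 fun u => (hQd u).continuousAt
  set ψ : ℝ → ℝ := fun u => ∫ v in (0 : ℝ)..u, (b - Q v) with hψdef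
  have hψd : ∀ u, HasDerivAt ψ (b - Q u) u := fun u =>
    ((continuous_const.sub hQ).integral_hasStrictDerivAt 0 u).hasDerivAt
  have hψ : Continuous ψ := continuous_iff_continuousAt.2 fun x => (hψd x).continuousAt
  have hφ : ∀ s u, HasDerivAt (fun u => (b - s) * u - ψ u) (Q u - s) u := fun s u => by
    refine (((hasDerivAt_id u).const_mul (b - s)).sub (hψd u)).congr_deriv ?_
    ring
  -- The `u`-derivative of `(b - s) u - ψ u` is `Q u - s`, so only `∇_θ F` needs to be dominated.
  have first : ∀ θ ∈ Θ, DifferentiableAt ℝ R θ ∧ ∀ j, partialDeriv j R θ =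
      ∫ s in Icc a b, (Q (cdf a ρ s θ) - s) * partialDeriv j (cdf a ρ s) θ := by
    intro θ hθ
    obtain ⟨N, hNo, hθN, hNΘ, ⟨M, hM⟩, -⟩ :=
      exists_hessianIntegrand_bound hab hΘ hρ hdom hQ hm hgm hθ
    have hpart : ∀ η ∈ Θ, ∀ s ∈ Icc a b, ∀ i,
        partialDeriv i (fun η => (b - s) * cdf a ρ s η - ψ (cdf a ρ s η)) η =
          (Q (cdf a ρ s η) - s) * partialDeriv i (cdf a ρ s) η := fun η hη s hs i =>
      partialDeriv_comp i (hφ s _) (hρ.differentiableAt_cdf hΘ hη hs)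
    have hcont : ∀ η ∈ Θ, ContinuousOn
        (fun s => (b - s) * cdf a ρ s η - ψ (cdf a ρ s η)) (Icc a b) := fun η hη =>
      ((continuousOn_const.sub continuousOn_id).mul (hρ.continuousOn_cdf hab hη)).sub
        (hψ.comp_continuousOn (hρ.continuousOn_cdf hab hη))
    have key := differentiableAt_integral_of_partialDeriv_le (μ := volume.restrict (Icc a b))
      (f := fun s η => (b - s) * cdf a ρ s η - ψ (cdf a ρ s η)) (hNo.mem_nhds hθN)
      (fun η hη => (hcont η (hNΘ hη)).aestronglyMeasurable measurableSet_Icc)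
      (hcont θ hθ).integrableOn_Icc
      ((ae_restrict_mem measurableSet_Icc).mono fun s hs η hη =>
        ((hφ s _).comp_hasFDerivAt η
          (hρ.differentiableAt_cdf hΘ (hNΘ hη) hs).hasFDerivAt).differentiableAt)
      fun i => ⟨fun _ => M, integrable_const _,
        (ae_restrict_mem measurableSet_Icc).mono fun s hs η hη => by
          rw [hpart η (hNΘ hη) s hs i]
          exact hM η hη s hs i⟩
    have hev : R =ᶠ[𝓝 θ] fun η => C + ∫ s in Icc a b, ((b - s) * cdf a ρ s η - ψ (cdf a ρ s η)) :=
      eventually_of_mem (hΘ.mem_nhds hθ) hR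
    refine ⟨(key.1.const_add C).congr_of_eventuallyEq hev, fun j => ?_⟩
    rw [partialDeriv, hev.fderiv_eq, fderiv_const_add]
    exact (key.2 j).trans (setIntegral_congr_fun measurableSet_Icc fun s hs => hpart θ hθ s hs j)
  -- The first derivative involves `F` and `∇_θ F` only, so it can be differentiated in the same way.
  have second : ∀ θ ∈ Θ, ∀ j, DifferentiableAt ℝ (partialDeriv j R) θ ∧ ∀ i,
      partialDeriv i (partialDeriv j R) θ =
        ∫ s in Icc a b, hessianIntegrand a ρ g Q θ i j s := by
    intro θ hθ j
    obtain ⟨N, hNo, hθN, hNΘ, ⟨M, hM⟩, hmax⟩ :=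
      exists_hessianIntegrand_bound hab hΘ hρ hdom hQ hm hgm hθ
    have hmeas : ∀ η ∈ N, AEStronglyMeasurable
        (fun s => (Q (cdf a ρ s η) - s) * partialDeriv j (cdf a ρ s) η)
        (volume.restrict (Icc a b)) := fun η hη =>
      aestronglyMeasurable_quantile_mul hab hΘ hρ hQ (hNΘ hη) j
    have key := differentiableAt_integral_of_partialDeriv_le (μ := volume.restrict (Icc a b))
      (f := fun s η => (Q (cdf a ρ s η) - s) * partialDeriv j (cdf a ρ s) η)
      (hNo.mem_nhds hθN) hmeas
      (Integrable.of_bound (hmeas θ hθN) M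
        ((ae_restrict_mem measurableSet_Icc).mono fun s hs => hM θ hθN s hs j))
      ((ae_restrict_mem measurableSet_Icc).mono fun s hs η hη =>
        (partialDeriv_quantile_mul hΘ hρ hQd (hNΘ hη) hs j j).1)
      fun i => by
        obtain ⟨k, hk, hle⟩ := hmax i j
        refine ⟨k, hk, ?_⟩
        filter_upwards [hle, ae_restrict_mem measurableSet_Icc] with s hs hsm η hη
        rw [(partialDeriv_quantile_mul hΘ hρ hQd (hNΘ hη) hsm i j).2]
        exact hs η hη
    have hev : partialDeriv j R =ᶠ[𝓝 θ]
        fun η => ∫ s in Icc a b, (Q (cdf a ρ s η) - s) * partialDeriv j (cdf a ρ s) η :=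
      eventually_of_mem (hΘ.mem_nhds hθ) fun η hη => (first η hη).2 j
    refine ⟨key.1.congr_of_eventuallyEq hev, fun i => ?_⟩
    rw [partialDeriv, hev.fderiv_eq]
    exact (key.2 i).trans (setIntegral_congr_fun measurableSet_Icc fun s hs =>
      (partialDeriv_quantile_mul hΘ hρ hQd hθ hs i j).2)
  refine ⟨fun θ hθ => (first θ hθ).1.differentiableWithinAt, fun θ hθ => ?_,
    fun θ hθ i j => (second θ hθ j).2 i⟩
  have : fderiv ℝ R = fun η => ∑ i, partialDeriv i R η • EuclideanSpace.proj (𝕜 := ℝ) i :=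
    funext fun η => fderiv_eq_sum_partialDeriv R η
  rw [this]
  exact (DifferentiableAt.fun_sum fun i _ =>
    (second θ hθ i).1.smul_const _).differentiableWithinAt

/-- The Hessian converges by dominated convergence, and its integrand at the target parameter is
that of the matrix `∫ (∇_θ F)ᵀ ∇_θ F / ρ`, since `Q ∘ F = id` there. -/
theorem tendsto_integral_hessianIntegrand (hab : a ≤ b) (hΘ : IsOpen Θ)
    (hρ : IsStatisticalModel a b Θ ρ) (hdom : DominationAssumption a b Θ ρ)
    (hg : Continuous g) {m : ℝ} (hm : 0 < m) (hgm : ∀ x, m ≤ g x)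
    (hgρ : ∀ x ∈ Icc a b, g x = ρ x θ) (hQd : ∀ u, HasDerivAt Q (g (Q u))⁻¹ u)
    (hQ : ∀ x ∈ Icc a b, Q (cdf a ρ x θ) = x) (hθ : θ ∈ Θ) (i j : Fin d) :
    Tendsto (fun η => ∫ s in Icc a b, hessianIntegrand a ρ g Q η i j s) (𝓝 θ)
      (𝓝 (cdfMatrix a b ρ θ i j)) := by
  have hQc : Continuous Q := continuous_iff_continuousAt.2 fun u => (hQd u).continuousAt
  obtain ⟨N, hNo, hθN, hNΘ, -, hmax⟩ :=
    exists_hessianIntegrand_bound hab hΘ hρ hdom hQc hm hgm hθ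
  obtain ⟨k, hk, hle⟩ := hmax i j
  refine tendsto_integral_filter_of_dominated_convergence k
    (eventually_of_mem (hΘ.mem_nhds hθ) fun η hη => ?_)
    (eventually_of_mem (hNo.mem_nhds hθN) fun η hη => hle.mono fun s hs => hs η hη) hk ?_
  · have hQF := hQc.comp_aestronglyMeasurable (hρ.aestronglyMeasurable_cdf hab hη)
    have hginv : Continuous fun x => (g x)⁻¹ := hg.inv₀ fun x => (hm.trans_le (hgm x)).ne'
    exact ((hQF.sub continuous_id.aestronglyMeasurable).mul
      (hρ.aestronglyMeasurable_partialDeriv_partialDeriv_cdf hab hΘ hη i j)).add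
      ((hρ.aestronglyMeasurable_partialDeriv_cdf hab hΘ hη j).mul
        ((hginv.comp_aestronglyMeasurable hQF).mul
          (hρ.aestronglyMeasurable_partialDeriv_cdf hab hΘ hη i)))
  · filter_upwards [ae_restrict_mem measurableSet_Icc] with s hs
    have hval : cdfIntegrand a ρ θ i j s = hessianIntegrand a ρ g Q θ i j s := by
      simp only [cdfIntegrand, hessianIntegrand, hQ s hs, hgρ s hs]
      ring
    rw [hval]
    have hQF : ContinuousAt (fun η => Q (cdf a ρ s η)) θ :=
      hQc.continuousAt.comp (hρ.differentiableAt_cdf hΘ hθ hs).continuousAt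
    exact ((hQF.sub continuousAt_const).mul
      (hρ.continuousAt_partialDeriv_partialDeriv_cdf hΘ hθ hs i j)).add
      ((hρ.contDiffAt_partialDeriv_cdf hΘ hθ hs j).continuousAt.mul
        (((hg.continuousAt.comp hQF).inv₀ (hm.trans_le (hgm _)).ne').mul
          (hρ.contDiffAt_partialDeriv_cdf hΘ hθ hs i).continuousAt))

end

end Objective

/-! ### Comparison of the preconditioned steps -/

section Steps

variable {d : ℕ}

theorem tendsto_matrix_inv {α : Type*} {l : Filter α} {A : α → Matrix (Fin d) (Fin d) ℝ}
    {A₀ : Matrix (Fin d) (Fin d) ℝ} (hA : Tendsto A l (𝓝 A₀)) (h₀ : IsUnit A₀) :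
    (∀ᶠ x in l, IsUnit (A x)) ∧ Tendsto (fun x => (A x)⁻¹) l (𝓝 A₀⁻¹) := by
  have hdet : Tendsto (fun x => (A x).det) l (𝓝 A₀.det) :=
    ((continuous_id.matrix_det).tendsto A₀).comp hA
  have h0 : A₀.det ≠ 0 := ((Matrix.isUnit_iff_isUnit_det A₀).1 h₀).ne_zero
  refine ⟨(hdet.eventually_ne h0).mono fun x hx =>
    (Matrix.isUnit_iff_isUnit_det _).2 hx.isUnit, ?_⟩
  have hadj : Tendsto (fun x => (A x).adjugate) l (𝓝 A₀.adjugate) :=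
    ((continuous_id.matrix_adjugate).tendsto A₀).comp hA
  simp only [Matrix.inv_def, Ring.inverse_eq_inv']
  exact (hdet.inv₀ h0).smul hadj

theorem isLittleO_toEuclideanLin {α : Type*} {l : Filter α} {A : α → Matrix (Fin d) (Fin d) ℝ}
    (hA : Tendsto A l (𝓝 0)) (v : α → EuclideanSpace ℝ (Fin d)) :
    (fun x => Matrix.toEuclideanLin (A x) (v x)) =o[l] v := by
  let L : Matrix (Fin d) (Fin d) ℝ →ₗ[ℝ]
      (EuclideanSpace ℝ (Fin d) →L[ℝ] EuclideanSpace ℝ (Fin d)) :=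
    LinearMap.toContinuousLinearMap.toLinearMap ∘ₗ Matrix.toEuclideanLin.toLinearMap
  have hL : Continuous L := L.continuous_of_finiteDimensional
  have hlim : Tendsto (fun x => ‖L (A x)‖) l (𝓝 0) := by
    have := ((hL.tendsto 0).comp hA).norm
    simpa using this
  refine Asymptotics.isLittleO_iff.2 fun c hc => ?_
  filter_upwards [hlim.eventually_le_const hc] with x hx
  exact ((L (A x)).le_opNorm (v x)).trans (mul_le_mul_of_nonneg_right hx (norm_nonneg _))

theorem isLittleO_preconditionedStep_sub {l : Filter (EuclideanSpace ℝ (Fin d))}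
    {P H : EuclideanSpace ℝ (Fin d) → Matrix (Fin d) (Fin d) ℝ}
    {A : Matrix (Fin d) (Fin d) ℝ} (hP : Tendsto P l (𝓝 A)) (hH : Tendsto H l (𝓝 A))
    (hA : IsUnit A) (R : EuclideanSpace ℝ (Fin d) → ℝ) (τ : ℝ) :
    (fun θ => preconditionedStep (P θ) R τ θ - preconditionedStep (H θ) R τ θ)
      =o[l] fun θ => gradient R θ := by
  have hlim : Tendsto (fun θ => τ • ((H θ)⁻¹ - (P θ)⁻¹)) l (𝓝 0) := by
    have := ((tendsto_matrix_inv hH hA).2.sub (tendsto_matrix_inv hP hA).2).const_smul τ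
    simpa using this
  refine (isLittleO_toEuclideanLin hlim (gradient R)).congr_left fun θ => ?_
  simp only [preconditionedStep, map_smul, map_sub, LinearMap.smul_apply, LinearMap.sub_apply,
    smul_sub]
  abel

end Steps

end WassersteinNG

theorem mainTheorem2 (d : ℕ) (a b : ℝ) (hab : a < b)
    (Θ : Set (EuclideanSpace ℝ (Fin d))) (hΘ : IsOpen Θ)
    (ρ : ℝ → EuclideanSpace ℝ (Fin d) → ℝ)
    (hρ : WassersteinNG.IsStatisticalModel a b Θ ρ)
    (hell : WassersteinNG.EllipticAssumption a b Θ ρ)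
    (hdom : WassersteinNG.DominationAssumption a b Θ ρ)
    (θstar : EuclideanSpace ℝ (Fin d)) (hθstar : θstar ∈ Θ)
    (ρstar : ℝ → ℝ) (hρstar : ∀ x ∈ Set.Icc a b, ρstar x = ρ x θstar)
    (R : EuclideanSpace ℝ (Fin d) → ℝ)
    (hR : R = WassersteinNG.objective a b ρ ρstar) :
    -- `R` is twice differentiable on `Θ`, so that `∇R` and `∇²R` exist there
    (DifferentiableOn ℝ R Θ ∧ DifferentiableOn ℝ (fderiv ℝ R) Θ) ∧
    -- the integral in the limit converges
    (∀ i j : Fin d,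
      MeasureTheory.IntegrableOn (WassersteinNG.cdfIntegrand a ρ θstar i j) (Set.Icc a b)) ∧
    -- the limit of the Hessian, and its value
    Filter.Tendsto (fun θ => WassersteinNG.hessianMatrix R θ) (nhds θstar)
      (nhds (WassersteinNG.cdfMatrix a b ρ θstar)) ∧
    WassersteinNG.cdfMatrix a b ρ θstar = WassersteinNG.metricMatrix a b ρ θstar ∧
    -- natural gradient descent is asymptotically Newton's method
    Filter.Tendsto
      (fun θ => WassersteinNG.hessianMatrix R θ - WassersteinNG.metricMatrix a b ρ θ)
      (nhds θstar) (nhds 0) ∧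
    ((WassersteinNG.metricMatrix a b ρ θstar).PosDef →
      (∀ᶠ θ in nhds θstar,
        IsUnit (WassersteinNG.metricMatrix a b ρ θ) ∧
        IsUnit (WassersteinNG.hessianMatrix R θ)) ∧
      ∀ τ : ℝ,
        (fun θ =>
          WassersteinNG.preconditionedStep (WassersteinNG.metricMatrix a b ρ θ) R τ θ -
          WassersteinNG.preconditionedStep (WassersteinNG.hessianMatrix R θ) R τ θ)
        =o[nhds θstar] fun θ => gradient R θ) := by
  obtain ⟨g, Q, C, hg, ⟨m, hm, hgm⟩, hgρ, hQd, hQ, hobj⟩ :=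
    WassersteinNG.exists_objective_eq hab.le hρ hθstar hρstar
  rw [← hR] at hobj
  obtain ⟨hR1, hR2, hhess⟩ :=
    WassersteinNG.derivatives_of_eq_integral hab.le hΘ hρ hdom hm hgm hQd hobj
  obtain ⟨hint, hcdf⟩ :=
    WassersteinNG.integrableOn_cdfIntegrand_and_tendsto_cdfMatrix hab.le hΘ hρ hdom hθstar
  have hH : Tendsto (fun θ => WassersteinNG.hessianMatrix R θ) (𝓝 θstar)
      (𝓝 (WassersteinNG.cdfMatrix a b ρ θstar)) := by
    refine tendsto_pi_nhds.2 fun i => tendsto_pi_nhds.2 fun j => ?_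
    refine (WassersteinNG.tendsto_integral_hessianIntegrand hab.le hΘ hρ hdom hg hm hgm hgρ hQd hQ
      hθstar i j).congr' ?_
    exact eventually_of_mem (hΘ.mem_nhds hθstar) fun θ hθ => (hhess θ hθ i j).symm
  have hmet : ∀ θ ∈ Θ, WassersteinNG.cdfMatrix a b ρ θ = WassersteinNG.metricMatrix a b ρ θ :=
    fun θ hθ => (WassersteinNG.metricMatrix_eq_cdfMatrix hab hΘ hρ hell hdom hθ).symm
  have hG : Tendsto (fun θ => WassersteinNG.metricMatrix a b ρ θ) (𝓝 θstar)
      (𝓝 (WassersteinNG.cdfMatrix a b ρ θstar)) :=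
    hcdf.congr' (eventually_of_mem (hΘ.mem_nhds hθstar) hmet)
  refine ⟨⟨hR1, hR2⟩, hint, hH, hmet θstar hθstar, ?_, fun hpos => ?_⟩
  · simpa using hH.sub hG
  · rw [← hmet θstar hθstar] at hpos
    have hunit := hpos.isUnit
    exact ⟨(WassersteinNG.tendsto_matrix_inv hG hunit).1.and
      (WassersteinNG.tendsto_matrix_inv hH hunit).1,
      fun τ => WassersteinNG.isLittleO_preconditionedStep_sub hG hH hunit R τ⟩
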